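/- Let $R$ be a ring with identity; modules are left $R$-modules unless stated otherwise, and chain complexes are unbounded, indexed by $\mathbb Z$, with differentials lowering degree. *Conventions.* A (left or right) module is of type $FP_\infty$ if it has a projective resolution by finitely generated projective modules. A chain complex is finitely generated if, whenever it is a sum of a family of subcomplexes, it is the sum of finitely many of them; it is of type $FP_\infty$ if it has a projective resolution (in the category of chain complexes) by finitely generated projective complexes. A module $N$ is level if $\mathrm{Tor}_1^R(M,N)=0$ for every right $R$-module $M$ of type $FP_\infty$. For a complex $X$ of right modules and a complex $Y$ of left modules, $X\,\overline\otimes\,Y$ is the complex of abelian groups with $(X\,\overline\otimes\,Y)_n=(X\otimes_R Y)_n/B_n(X\otimes_R Y)$, where $B_n$ denotes the boundaries in degree $n$, and differential $\overline{x\otimes y}\mapsto\overline{dx\otimes y}$; $\overline{\mathrm{Tor}}_i$ are the left derived functors of $\overline\otimes$. A chain complex $L$ is level if $\overline{\mathrm{Tor}}_1(X,L)=0$ for every complex $X$ of right modules of type $FP_\infty$. A module (respectively, a chain complex) $X$ is Gorenstein AC-projective if there is an exact complex $\cdots\to P_1\to P_0\to P^0\to P^1\to\cdots$ of projective modules (respectively,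 of projective chain complexes) with $X\cong\ker(P^0\to P^1)$ which remains exact after applying $\mathrm{Hom}(-,L)$ (the group of module homomorphisms, respectively of chain maps) for every level module (respectively, level chain complex) $L$. Finally, $\mathit{Hom}(X,Y)$ is the complex of abelian groups with $\mathit{Hom}(X,Y)_n=\prod_{k\in\mathbb Z}\mathrm{Hom}_R(X_k,Y_{k+n})$ and $(\delta_n f)_k=d_{k+n}f_k-(-1)^nf_{k-1}d_k$. **Theorem.** For a chain complex $X$ of $R$-modules the following are equivalent: 1. $X$ is a Gorenstein AC-projective complex; 2. each $X_n$ is a Gorenstein AC-projective module, and the complex $\mathit{Hom}(X,L)$ is exact for every level chain complex $L$; 3. each $X_n$ is a Gorenstein AC-projective module, and every chain map $f\colon X\to L$ with $L$ a level chain complex is null homotopic. -/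

import Mathlib

open CategoryTheory CategoryTheory.Limits
open scoped TensorProduct

universe u

namespace GorensteinAC

/-! ### The tensor product over a not necessarily commutative ring

Right `R`-modules are modules over the opposite ring `Rᵐᵒᵖ`, with `m · r = op r • m`. -/

section Tensor

variable (R : Type u) [Ring R]

/-- The subgroup of `M ⊗_ℤ N` generated by all `(m · r) ⊗ n - m ⊗ (r · n)`. -/
def balancedRelations (M N : Type u) [AddCommGroup M] [Module Rᵐᵒᵖ M]
    [AddCommGroup N] [Module R N] : AddSubgroup (M ⊗[ℤ] N) :=
  AddSubgroup.closure
    {t | ∃ (m : M) (r : R) (n : N), t = (MulOpposite.op r • m) ⊗ₜ[ℤ] n - m ⊗ₜ[ℤ] (r • n)}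

/-- The abelian group `M ⊗_R N`, for a right module `M` and a left module `N`. -/
abbrev BalancedTensor (M N : Type u) [AddCommGroup M] [Module Rᵐᵒᵖ M]
    [AddCommGroup N] [Module R N] : Type u :=
  (M ⊗[ℤ] N) ⧸ balancedRelations R M N

namespace BalancedTensor

/-- The element `m ⊗ n` of `M ⊗_R N`. -/
def tmul {M N : Type u} [AddCommGroup M] [Module Rᵐᵒᵖ M] [AddCommGroup N] [Module R N]
    (m : M) (n : N) : BalancedTensor R M N :=
  QuotientAddGroup.mk (m ⊗ₜ[ℤ] n)

variable {R}

section

variable {M N : Type u} [AddCommGroup M] [Module Rᵐᵒᵖ M] [AddCommGroup N] [Module R N]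

theorem add_tmul (m m' : M) (n : N) : tmul R (m + m') n = tmul R m n + tmul R m' n :=
  congrArg QuotientAddGroup.mk (TensorProduct.add_tmul m m' n)

theorem tmul_add (m : M) (n n' : N) : tmul R m (n + n') = tmul R m n + tmul R m n' :=
  congrArg QuotientAddGroup.mk (TensorProduct.tmul_add m n n')

theorem smul_tmul (m : M) (r : R) (n : N) :
    tmul R (MulOpposite.op r • m) n = tmul R m (r • n) := by
  refine (QuotientAddGroup.eq_iff_sub_mem).2 ?_
  exact AddSubgroup.subset_closure ⟨m, r, n, rfl⟩

theorem hom_ext {A : Type*} [AddCommGroup A] {f g : BalancedTensor R M N →+ A}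
    (h : ∀ (m : M) (n : N), f (tmul R m n) = g (tmul R m n)) : f = g := by
  refine QuotientAddGroup.addMonoidHom_ext _ (AddMonoidHom.ext fun t => ?_)
  induction t using TensorProduct.induction_on with
  | zero => rw [map_zero, map_zero]
  | tmul m n => exact h m n
  | add x y hx hy => rw [map_add, map_add, hx, hy]

end

/-- Functoriality of `M ⊗_R N`: the map `x ⊗ y ↦ f x ⊗ g y`. -/
noncomputable def map {M M' N N' : Type u}
    [AddCommGroup M] [Module Rᵐᵒᵖ M] [AddCommGroup M'] [Module Rᵐᵒᵖ M']
    [AddCommGroup N] [Module R N] [AddCommGroup N'] [Module R N']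
    (f : M →ₗ[Rᵐᵒᵖ] M') (g : N →ₗ[R] N') :
    BalancedTensor R M N →+ BalancedTensor R M' N' :=
  QuotientAddGroup.map _ _
    (TensorProduct.map f.toAddMonoidHom.toIntLinearMap
      g.toAddMonoidHom.toIntLinearMap).toAddMonoidHom (by
      refine (AddSubgroup.closure_le _).2 ?_
      rintro _ ⟨m, r, n, rfl⟩
      refine AddSubgroup.subset_closure ⟨f m, r, g n, ?_⟩
      refine (map_sub _ _ _).trans ?_
      refine congrArg₂ (· - ·) ?_ ?_
      · exact congrArg (· ⊗ₜ[ℤ] g n) (f.map_smul (MulOpposite.op r) m)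
      · exact congrArg (f m ⊗ₜ[ℤ] ·) (g.map_smul r n))

@[simp]
theorem map_tmul {M M' N N' : Type u}
    [AddCommGroup M] [Module Rᵐᵒᵖ M] [AddCommGroup M'] [Module Rᵐᵒᵖ M']
    [AddCommGroup N] [Module R N] [AddCommGroup N'] [Module R N']
    (f : M →ₗ[Rᵐᵒᵖ] M') (g : N →ₗ[R] N') (m : M) (n : N) :
    map f g (tmul R m n) = tmul R (f m) (g n) := rfl

end BalancedTensor

/-- The bifunctor `(M, N) ↦ M ⊗_R N` from right and left modules to abelian groups. -/
noncomputable def tensorBifunctor :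
    ModuleCat.{u} Rᵐᵒᵖ ⥤ ModuleCat.{u} R ⥤ AddCommGrpCat.{u} where
  obj M :=
    { obj := fun N => AddCommGrpCat.of (BalancedTensor R M N)
      map := fun g => AddCommGrpCat.ofHom (BalancedTensor.map (LinearMap.id : M →ₗ[Rᵐᵒᵖ] M) g.hom)
      map_id := fun N => AddCommGrpCat.hom_ext (BalancedTensor.hom_ext fun _ _ => rfl)
      map_comp := fun _ _ => AddCommGrpCat.hom_ext (BalancedTensor.hom_ext fun _ _ => rfl) }
  map f :=
    { app := fun N =>
        AddCommGrpCat.ofHom (BalancedTensor.map f.hom (LinearMap.id : N →ₗ[R] N))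
      naturality := fun _ _ _ =>
        AddCommGrpCat.hom_ext (BalancedTensor.hom_ext fun _ _ => rfl) }
  map_id M := by
    ext N : 2
    exact AddCommGrpCat.hom_ext (BalancedTensor.hom_ext fun _ _ => rfl)
  map_comp f f' := by
    ext N : 2
    exact AddCommGrpCat.hom_ext (BalancedTensor.hom_ext fun _ _ => rfl)

instance : (tensorBifunctor R).Additive where
  map_add {M M' f g} := by
    ext N : 2
    exact AddCommGrpCat.hom_ext (BalancedTensor.hom_ext fun m n =>
      BalancedTensor.add_tmul (f.hom m) (g.hom m) n)

instance (M : ModuleCat.{u} Rᵐᵒᵖ) : ((tensorBifunctor R).obj M).Additive where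
  map_add {_ _ f g} := AddCommGrpCat.hom_ext (BalancedTensor.hom_ext fun m n =>
    BalancedTensor.tmul_add m (f.hom n) (g.hom n))

instance (N : ModuleCat.{u} R) : ((tensorBifunctor R).flip.obj N).Additive where
  map_add {_ _ f g} := AddCommGrpCat.hom_ext (BalancedTensor.hom_ext fun m n =>
    BalancedTensor.add_tmul (f.hom m) (g.hom m) n)

end Tensor

/-! ### Enough projectives in the category of complexes -/

section EnoughProjectives

variable {S : Type u} [Ring S]

/-- The `n`-disk on `M`: the complex `M = M` in degrees `n` and `n - 1`. -/
noncomputable abbrev disk (M : ModuleCat.{u} S) (n : ℤ) : ChainComplex (ModuleCat.{u} S) ℤ :=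
  HomologicalComplex.double (𝟙 M) (c := ComplexShape.down ℤ) (i₀ := n) (i₁ := n - 1) (by simp)

/-- Maps from the `n`-disk on `M` to `Y` are the same as maps `M ⟶ Y_n`. -/
noncomputable abbrev diskCorepresents (M : ModuleCat.{u} S) (n : ℤ) :
    (HomologicalComplex.eval (ModuleCat.{u} S) (ComplexShape.down ℤ) n ⋙
      coyoneda.obj (Opposite.op M)).CorepresentableBy (disk M n) :=
  HomologicalComplex.evalCompCoyonedaCorepresentableByDoubleId
    (c := ComplexShape.down ℤ) (i₀ := n) (i₁ := n - 1) (by simp) (by lia) M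

theorem projective_disk (M : ModuleCat.{u} S) [Projective M] (n : ℤ) :
    Projective (disk M n) := by
  let e := diskCorepresents M n
  refine ⟨fun {E Y} f p _ => ?_⟩
  have : Epi (p.f n) := by
    have := preservesEpimorphisms_of_preservesColimitsOfShape
      (HomologicalComplex.eval (ModuleCat.{u} S) (ComplexShape.down ℤ) n)
    exact this.preserves p
  let g : M ⟶ Y.X n := e.homEquiv f
  let h : M ⟶ E.X n := Projective.factorThru g (p.f n)
  have hg : h ≫ p.f n = g := Projective.factorThru_comp g (p.f n)
  refine ⟨e.homEquiv.symm h, ?_⟩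
  apply e.homEquiv.injective
  rw [e.homEquiv_comp]
  exact (congrArg (fun t : M ⟶ E.X n => t ≫ p.f n) (e.homEquiv.apply_symm_apply h)).trans hg

instance : EnoughProjectives (ChainComplex (ModuleCat.{u} S) ℤ) where
  presentation X := by
    let D (n : ℤ) := disk (Projective.over (X.X n)) n
    let e (n : ℤ) := diskCorepresents (Projective.over (X.X n)) n
    let φ (n : ℤ) : D n ⟶ X := (e n).homEquiv.symm (Projective.π (X.X n))
    have hφ (n : ℤ) : Epi ((φ n).f n) := by
      let a : Projective.over (X.X n) ⟶ (D n).X n := (e n).homEquiv (𝟙 _)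
      have h : a ≫ (φ n).f n = Projective.π (X.X n) := by
        have h := (e n).homEquiv_comp (φ n) (𝟙 _)
        rw [Category.id_comp] at h
        exact h.symm.trans ((e n).homEquiv.apply_symm_apply _)
      have : Epi (a ≫ (φ n).f n) := by rw [h]; infer_instance
      exact epi_of_epi a _
    have (n : ℤ) : Projective (D n) := projective_disk _ n
    have h0 (n : ℤ) : Epi ((Sigma.desc φ).f n) := by
      have h : (Sigma.ι D n).f n ≫ (Sigma.desc φ).f n = (φ n).f n := by
        rw [← HomologicalComplex.comp_f, Sigma.ι_desc]
      have : Epi ((Sigma.ι D n).f n ≫ (Sigma.desc φ).f n) := by rw [h]; exact hφ n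
      exact epi_of_epi ((Sigma.ι D n).f n) _
    exact ⟨{
      p := ∐ D
      projective := ⟨fun {E Y} a p _ =>
        ⟨Sigma.desc fun n => Projective.factorThru (Sigma.ι D n ≫ a) p, by
          apply Sigma.hom_ext
          intro n
          rw [Sigma.ι_desc_assoc, Projective.factorThru_comp]⟩⟩
      f := Sigma.desc φ
      epi := HomologicalComplex.epi_of_epi_f _ h0 }⟩

end EnoughProjectives

/-! ### The modified tensor product of complexes -/

/-- The sign `(-1)^i` for complexes whose differentials lower degree. -/
instance : (ComplexShape.down ℤ).TensorSigns where
  ε' := MonoidHom.mk' (fun i : Multiplicative ℤ => Int.negOnePow i.toAdd)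
    (fun i j => Int.negOnePow_add i.toAdd j.toAdd)
  rel_add p q r hpq := by
    change q + 1 = p at hpq
    change q + r + 1 = p + r
    lia
  add_rel p q r hpq := by
    change q + 1 = p at hpq
    change r + q + 1 = r + p
    lia
  ε'_succ p q hpq := by
    change q + 1 = p at hpq
    change Int.negOnePow q = - Int.negOnePow p
    rw [← hpq, Int.negOnePow_succ, neg_neg]

section ModifiedTensor

variable {R : Type u} [Ring R]

/-- The usual tensor product `X ⊗_R Y` of complexes, with `(X ⊗ Y)_n = ⨁_{i+j=n} X_i ⊗_R Y_j` and
`d (x ⊗ y) = dx ⊗ y + (-1)^i x ⊗ dy` for `x` of degree `i`. -/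
noncomputable abbrev tensorComplex (X : ChainComplex (ModuleCat.{u} Rᵐᵒᵖ) ℤ)
    (Y : ChainComplex (ModuleCat.{u} R) ℤ) : ChainComplex AddCommGrpCat.{u} ℤ :=
  HomologicalComplex.mapBifunctor X Y (tensorBifunctor R) (ComplexShape.down ℤ)

/-- The map `x ⊗ y ↦ dx ⊗ y` from degree `n` to degree `m` of the usual tensor product
(it is zero unless `m = n - 1`). -/
noncomputable abbrev tensorD (X : ChainComplex (ModuleCat.{u} Rᵐᵒᵖ) ℤ)
    (Y : ChainComplex (ModuleCat.{u} R) ℤ) (n m : ℤ) :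
    (tensorComplex X Y).X n ⟶ (tensorComplex X Y).X m :=
  HomologicalComplex.mapBifunctor.D₁ X Y (tensorBifunctor R) (ComplexShape.down ℤ) n m

theorem tensorD_comp_tensorD (X : ChainComplex (ModuleCat.{u} Rᵐᵒᵖ) ℤ)
    (Y : ChainComplex (ModuleCat.{u} R) ℤ) (l n m : ℤ) :
    tensorD X Y l n ≫ tensorD X Y n m = 0 :=
  HomologicalComplex₂.D₁_D₁ _ _ _ _ _

theorem d_comp_tensorD (X : ChainComplex (ModuleCat.{u} Rᵐᵒᵖ) ℤ)
    (Y : ChainComplex (ModuleCat.{u} R) ℤ) (l n m : ℤ) :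
    (tensorComplex X Y).d l n ≫ tensorD X Y n m =
      - (tensorD X Y l n ≫ (tensorComplex X Y).d n m) := by
  have h := HomologicalComplex₂.D₂_D₁
    ((((tensorBifunctor R).mapBifunctorHomologicalComplex (ComplexShape.down ℤ)
      (ComplexShape.down ℤ)).obj X).obj Y) (ComplexShape.down ℤ) l n m
  rw [HomologicalComplex.mapBifunctor.d_eq, HomologicalComplex.mapBifunctor.d_eq,
    Preadditive.add_comp, Preadditive.comp_add, tensorD_comp_tensorD, zero_add, zero_add]
  exact h

theorem mapBifunctorMap_comp_tensorD {X X' : ChainComplex (ModuleCat.{u} Rᵐᵒᵖ) ℤ}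
    (f : X ⟶ X') (Y : ChainComplex (ModuleCat.{u} R) ℤ) (n m : ℤ) :
    (HomologicalComplex.mapBifunctorMap f (𝟙 Y) (tensorBifunctor R) (ComplexShape.down ℤ)).f n ≫
      tensorD X' Y n m =
    tensorD X Y n m ≫
      (HomologicalComplex.mapBifunctorMap f (𝟙 Y) (tensorBifunctor R) (ComplexShape.down ℤ)).f m :=
  HomologicalComplex₂.total.mapAux.mapMap_D₁ _ _ _ _

/-- The modified tensor product of complexes: its degree `n` is
`(X ⊗ Y)_n / B_n (X ⊗ Y)`, and its differential sends the class of `x ⊗ y` to the class of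
`dx ⊗ y`. -/
noncomputable def modifiedTensorObj (X : ChainComplex (ModuleCat.{u} Rᵐᵒᵖ) ℤ)
    (Y : ChainComplex (ModuleCat.{u} R) ℤ) : ChainComplex AddCommGrpCat.{u} ℤ where
  X n := (tensorComplex X Y).opcycles n
  d n m := (tensorComplex X Y).descOpcycles (tensorD X Y n m ≫ (tensorComplex X Y).pOpcycles m)
    (n + 1) (by simp) (by
      rw [← Category.assoc, d_comp_tensorD, Preadditive.neg_comp, Category.assoc,
        HomologicalComplex.d_pOpcycles, comp_zero, neg_zero])
  shape n m h := by
    rw [← cancel_epi ((tensorComplex X Y).pOpcycles n), HomologicalComplex.p_descOpcycles,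
      comp_zero]
    rw [show tensorD X Y n m = 0 from HomologicalComplex₂.D₁_shape _ _ _ _ h, zero_comp]
  d_comp_d' l n m _ _ := by
    rw [← cancel_epi ((tensorComplex X Y).pOpcycles l), HomologicalComplex.p_descOpcycles_assoc,
      Category.assoc, HomologicalComplex.p_descOpcycles, ← Category.assoc, tensorD_comp_tensorD,
      zero_comp, comp_zero]

/-- The map `f ⊗̄ Y` induced by a chain map `f`. -/
noncomputable def modifiedTensorMap {X X' : ChainComplex (ModuleCat.{u} Rᵐᵒᵖ) ℤ} (f : X ⟶ X')
    (Y : ChainComplex (ModuleCat.{u} R) ℤ) : modifiedTensorObj X Y ⟶ modifiedTensorObj X' Y where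
  f n := HomologicalComplex.opcyclesMap
    (HomologicalComplex.mapBifunctorMap f (𝟙 Y) (tensorBifunctor R) (ComplexShape.down ℤ)) n
  comm' n m _ := by
    dsimp only [modifiedTensorObj]
    rw [← cancel_epi ((tensorComplex X Y).pOpcycles n), HomologicalComplex.p_opcyclesMap_assoc,
      HomologicalComplex.p_descOpcycles, HomologicalComplex.p_descOpcycles_assoc, Category.assoc,
      HomologicalComplex.p_opcyclesMap, ← Category.assoc, mapBifunctorMap_comp_tensorD,
      Category.assoc]

variable (R) in
/-- The modified tensor product with a fixed complex `Y` of left modules, as a functor from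
complexes of right modules to complexes of abelian groups. -/
noncomputable def modifiedTensor (Y : ChainComplex (ModuleCat.{u} R) ℤ) :
    ChainComplex (ModuleCat.{u} Rᵐᵒᵖ) ℤ ⥤ ChainComplex AddCommGrpCat.{u} ℤ where
  obj X := modifiedTensorObj X Y
  map f := modifiedTensorMap f Y
  map_id X := by
    ext n : 1
    dsimp only [modifiedTensorMap]
    have h : HomologicalComplex.mapBifunctorMap (𝟙 X) (𝟙 Y) (tensorBifunctor R)
        (ComplexShape.down ℤ) = 𝟙 _ := by
      ext n : 1
      apply HomologicalComplex.mapBifunctor.hom_ext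
      intro i₁ i₂ hi
      simp
    rw [h, HomologicalComplex.opcyclesMap_id]
    rfl
  map_comp {X X' X''} f g := by
    ext n : 1
    dsimp only [modifiedTensorMap, HomologicalComplex.comp_f]
    have h : HomologicalComplex.mapBifunctorMap (f ≫ g) (𝟙 Y) (tensorBifunctor R)
        (ComplexShape.down ℤ) =
        HomologicalComplex.mapBifunctorMap f (𝟙 Y) (tensorBifunctor R) (ComplexShape.down ℤ) ≫
        HomologicalComplex.mapBifunctorMap g (𝟙 Y) (tensorBifunctor R)
          (ComplexShape.down ℤ) := by
      ext n : 1
      apply HomologicalComplex.mapBifunctor.hom_ext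
      intro i₁ i₂ hi
      simp
    rw [h, HomologicalComplex.opcyclesMap_comp]
    rfl

instance (Y : ChainComplex (ModuleCat.{u} R) ℤ) : (modifiedTensor R Y).Additive where
  map_add {X X' f g} := by
    ext n : 1
    let F (h : X ⟶ X') := HomologicalComplex.mapBifunctorMap h (𝟙 Y) (tensorBifunctor R)
      (ComplexShape.down ℤ)
    suffices HomologicalComplex.opcyclesMap (F (f + g)) n =
        HomologicalComplex.opcyclesMap (F f) n + HomologicalComplex.opcyclesMap (F g) n from this
    rw [← cancel_epi ((tensorComplex X Y).pOpcycles n), Preadditive.comp_add,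
      HomologicalComplex.p_opcyclesMap, HomologicalComplex.p_opcyclesMap,
      HomologicalComplex.p_opcyclesMap, ← Preadditive.add_comp]
    congr 1
    apply HomologicalComplex.mapBifunctor.hom_ext
    intro i₁ i₂ hi
    rw [Preadditive.comp_add, HomologicalComplex.ι_mapBifunctorMap,
      HomologicalComplex.ι_mapBifunctorMap, HomologicalComplex.ι_mapBifunctorMap,
      HomologicalComplex.add_f_apply, Functor.map_add, NatTrans.app_add, Preadditive.add_comp]

end ModifiedTensor

/-! ### Modules and complexes of type `FP_∞`, and level modules and complexes -/

section Level

/-- A module is of type `FP_∞` if it has a projective resolution by finitely generated projective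
modules. -/
def IsFPInftyModule {S : Type u} [Ring S] (M : ModuleCat.{u} S) : Prop :=
  ∃ P : ProjectiveResolution M, ∀ i, Module.Finite S (P.complex.X i)

/-- A family of submodules `A n ≤ X_n` is a subcomplex of `X` if it is stable under the
differential. -/
def IsSubcomplex {S : Type u} [Ring S] (X : ChainComplex (ModuleCat.{u} S) ℤ)
    (A : ∀ n : ℤ, Submodule S (X.X n)) : Prop :=
  ∀ n m : ℤ, (A n).map (X.d n m).hom ≤ A m

/-- A complex is finitely generated if, whenever it is the sum of a family of subcomplexes, it is
the sum of finitely many members of the family. -/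
def IsFinitelyGeneratedComplex {S : Type u} [Ring S] (X : ChainComplex (ModuleCat.{u} S) ℤ) :
    Prop :=
  ∀ (I : Type u) (A : I → ∀ n : ℤ, Submodule S (X.X n)), (∀ i, IsSubcomplex X (A i)) →
    (∀ n, ⨆ i, A i n = ⊤) → ∃ J : Finset I, ∀ n, ⨆ i ∈ J, A i n = ⊤

/-- A complex is of type `FP_∞` if it has a projective resolution, in the category of complexes,
by finitely generated projective complexes. -/
def IsFPInftyComplex {S : Type u} [Ring S] (X : ChainComplex (ModuleCat.{u} S) ℤ) : Prop :=
  ∃ P : ProjectiveResolution X, ∀ i, IsFinitelyGeneratedComplex (P.complex.X i)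

variable {R : Type u} [Ring R]

/-- A left module `N` is level if `Tor_1^R(M, N) = 0` for all right modules `M` of type `FP_∞`;
here `Tor_1^R(-, N)` is the first left derived functor of `- ⊗_R N`. -/
def IsLevelModule (N : ModuleCat.{u} R) : Prop :=
  ∀ M : ModuleCat.{u} Rᵐᵒᵖ, IsFPInftyModule M →
    IsZero ((((tensorBifunctor R).flip.obj N).leftDerived 1).obj M)

/-- A complex `L` of left modules is level if the first left derived functor of the modified tensor
product `- ⊗̄ L` vanishes on all complexes `X` of right modules of type `FP_∞`. -/
def IsLevelComplex (L : ChainComplex (ModuleCat.{u} R) ℤ) : Prop :=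
  ∀ X : ChainComplex (ModuleCat.{u} Rᵐᵒᵖ) ℤ, IsFPInftyComplex X →
    IsZero (((modifiedTensor R L).leftDerived 1).obj X)

end Level

/-! ### Gorenstein AC-projective objects -/

section Gorenstein

/-- `X` is the kernel of `P⁰ ⟶ P¹` for some exact complex
`⋯ ⟶ P₁ ⟶ P₀ ⟶ P⁰ ⟶ P¹ ⟶ ⋯` of projective objects that remains exact after applying
`Hom(-, L)` for every `L` in the class `𝓛`. The terms `P⁰, P¹, …` sit in degrees `0, 1, …` and
the terms `P₀, P₁, …` in degrees `-1, -2, …`. -/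
def IsGorensteinProjectiveFor {C : Type*} [Category* C] [Abelian C] (𝓛 : C → Prop) (X : C) :
    Prop :=
  ∃ P : CochainComplex C ℤ, (∀ i, Projective (P.X i)) ∧ P.Acyclic ∧
    Nonempty (X ≅ kernel (P.d 0 1)) ∧
    ∀ L : C, 𝓛 L → (((preadditiveYoneda.obj L).mapHomologicalComplex _).obj P.op).Acyclic

variable {R : Type u} [Ring R]

/-- Gorenstein AC-projective modules. -/
def IsGorensteinACProjectiveModule (M : ModuleCat.{u} R) : Prop :=
  IsGorensteinProjectiveFor IsLevelModule M

/-- Gorenstein AC-projective complexes: here `Hom` is the group of chain maps. -/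
def IsGorensteinACProjectiveComplex (X : ChainComplex (ModuleCat.{u} R) ℤ) : Prop :=
  IsGorensteinProjectiveFor IsLevelComplex X

end Gorenstein

/-! ### The Hom-complex -/

section HomComplex

variable {R : Type u} [Ring R]

/-- Degree `n` of the Hom-complex: families of linear maps `X_p ⟶ Y_q`, one for each pair `(p, q)`
with `p + n = q`. -/
abbrev HomCochain (X Y : ChainComplex (ModuleCat.{u} R) ℤ) (n : ℤ) : Type u :=
  ∀ k : {k : ℤ × ℤ // k.1 + n = k.2}, (X.X k.1.1 ⟶ Y.X k.1.2)

/-- The differential `(δ f)_p = d f_p - (-1)^n f_{p-1} d` from degree `n` to degree `m = n - 1`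
(for other `m` this formula gives zero). -/
def homDifferential (X Y : ChainComplex (ModuleCat.{u} R) ℤ) (n m : ℤ) :
    HomCochain X Y n →+ HomCochain X Y m where
  toFun f k := f ⟨(k.1.1, k.1.1 + n), rfl⟩ ≫ Y.d (k.1.1 + n) k.1.2 -
    n.negOnePow • (X.d k.1.1 (k.1.2 - n) ≫ f ⟨(k.1.2 - n, k.1.2), by lia⟩)
  map_zero' := by
    funext k
    simp
  map_add' f g := by
    funext k
    simp only [Pi.add_apply, Preadditive.add_comp, Preadditive.comp_add, smul_add]
    abel

/-- The Hom-complex `Hom(X, Y)` of abelian groups, with degree `n` equal to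
`∏_p Hom(X_p, Y_{p+n})`. -/
def homComplex (X Y : ChainComplex (ModuleCat.{u} R) ℤ) : ChainComplex AddCommGrpCat.{u} ℤ where
  X n := AddCommGrpCat.of (HomCochain X Y n)
  d n m := AddCommGrpCat.ofHom (homDifferential X Y n m)
  shape n m h := by
    refine AddCommGrpCat.hom_ext (AddMonoidHom.ext fun f => ?_)
    funext ⟨⟨p, q⟩, hpq⟩
    change ¬ (m + 1 = n) at h
    change f ⟨(p, p + n), rfl⟩ ≫ Y.d (p + n) q -
      n.negOnePow • (X.d p (q - n) ≫ f ⟨(q - n, q), by lia⟩) = 0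
    rw [Y.shape (p + n) q (by change ¬ (q + 1 = p + n); lia),
      X.shape p (q - n) (by change ¬ (q - n + 1 = p); lia)]
    simp
  d_comp_d' n m l hnm hml := by
    refine AddCommGrpCat.hom_ext (AddMonoidHom.ext fun f => ?_)
    funext ⟨⟨p, q⟩, hpq⟩
    change m + 1 = n at hnm
    change l + 1 = m at hml
    change p + l = q at hpq
    subst hml hnm hpq
    change (f ⟨(p, p + (l + 1 + 1)), rfl⟩ ≫ Y.d (p + (l + 1 + 1)) (p + (l + 1)) -
      (l + 1 + 1).negOnePow • (X.d p (p + (l + 1) - (l + 1 + 1)) ≫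
        f ⟨(p + (l + 1) - (l + 1 + 1), p + (l + 1)), by lia⟩)) ≫ Y.d (p + (l + 1)) (p + l) -
      (l + 1).negOnePow • (X.d p (p + l - (l + 1)) ≫
        (f ⟨(p + l - (l + 1), p + l - (l + 1) + (l + 1 + 1)), rfl⟩ ≫
            Y.d (p + l - (l + 1) + (l + 1 + 1)) (p + l) -
          (l + 1 + 1).negOnePow • (X.d (p + l - (l + 1)) (p + l - (l + 1 + 1)) ≫
            f ⟨(p + l - (l + 1 + 1), p + l), by lia⟩))) = 0
    have key : ∀ a b c e : ℤ, a = b → ∀ (ha : a + (l + 1 + 1) = c) (hb : b + (l + 1 + 1) = e),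
        c = e → X.d p a ≫ f ⟨(a, c), ha⟩ ≫ Y.d c (p + l) = X.d p b ≫ f ⟨(b, e), hb⟩ ≫ Y.d e (p + l) := by
      rintro a b c e rfl ha hb rfl
      rfl
    have h1 := key (p + (l + 1) - (l + 1 + 1)) (p + l - (l + 1)) (p + (l + 1))
      (p + l - (l + 1) + (l + 1 + 1)) (by lia) (by lia) rfl (by lia)
    simp only [Preadditive.sub_comp, Preadditive.comp_sub, Category.assoc,
      HomologicalComplex.d_comp_d, HomologicalComplex.d_comp_d_assoc, comp_zero, zero_comp,
      Linear.units_smul_comp, Linear.comp_units_smul, smul_zero, sub_zero, zero_sub, h1,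
      Int.negOnePow_succ, neg_neg]
    simp

end HomComplex

end GorensteinAC

/-! An object is Gorenstein projective for a class `𝓛` exactly when it sits in a bi-infinite chain
of short exact sequences `0 ⟶ K i ⟶ P ⟶ K (i + 1) ⟶ 0` with `P` projective, along whose
monomorphisms all maps into `𝓛` extend (`SyzygyRel`). Leftward continuation needs only vanishing of
the positive Ext groups into `𝓛` and enough projectives. The work lies in continuing to the right.

From complexes to modules, the bridge is the disk functor. It is left adjoint to evaluation in its
top degree and right adjoint to evaluation in its bottom degree, and `⊗̄` with a disk is the
ordinary tensor product with a single term. Hence the terms of a level complex are level and disks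
on level modules are level. Since chain maps into a disk are module maps out of one term, evaluating
a complete resolution of `X` gives one of each `X_n`. Moreover a map from `X` to a level complex
extends to a projective complex, which is contractible, so it is null homotopic. Cycles of degree
`n` in the Hom-complex are chain maps to a shift of `L` and boundaries are the null homotopic ones;
as shifts of level complexes are level, conditions 2 and 3 agree.

Conversely, embed each `X_n` in a projective `Q_n` with Gorenstein AC-projective cokernel `C_n`, and
map `X` to the contractible complex with terms `Q_n ⊞ Q_{n-1}` by `(j, d j)`. The cokernel `Y` has
terms that are extensions of `C_n` by `Q_{n-1}`. They are Gorenstein AC-projective by closure under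
extensions (`IsGorensteinProjectiveFor.of_shortExact`), which relies on projective modules being
level. Termwise Ext vanishing makes the sequence of Hom-complexes short exact, so `Y` inherits both
conditions and the construction repeats (`exists_right_syzygy`). A map `X ⟶ L` extends to the
projective complex by extending a null homotopy componentwise. -/

namespace GorensteinAC

/-! ### Gorenstein projective objects as bi-infinite chains of syzygies. -/

section Abstract

universe v w

variable {C : Type w} [Category.{v} C] [Abelian C]

/-- There is a short exact sequence `0 ⟶ A ⟶ P ⟶ B ⟶ 0` with `P` projective such that
every map from `A` to an object in the class `𝓛` extends to `P`. -/
def SyzygyRel (𝓛 : C → Prop) (A B : C) : Prop :=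
  ∃ (P : C) (f : A ⟶ P) (g : P ⟶ B) (w : f ≫ g = 0), Projective P ∧
    (ShortComplex.mk f g w).ShortExact ∧
    ∀ L, 𝓛 L → ∀ u : A ⟶ L, ∃ v : P ⟶ L, f ≫ v = u

theorem yoneda_acyclic_iff (P : CochainComplex C ℤ) (L : C) :
    (((preadditiveYoneda.obj L).mapHomologicalComplex _).obj P.op).Acyclic ↔
      ∀ i (g : P.X (i + 1) ⟶ L), P.d i (i + 1) ≫ g = 0 →
        ∃ h : P.X (i + 1 + 1) ⟶ L, P.d (i + 1) (i + 1 + 1) ≫ h = g := by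
  have key : ∀ i : ℤ,
      (((preadditiveYoneda.obj L).mapHomologicalComplex _).obj P.op).ExactAt (i + 1) ↔
      ∀ (g : P.X (i + 1) ⟶ L), P.d i (i + 1) ≫ g = 0 →
        ∃ h : P.X (i + 1 + 1) ⟶ L, P.d (i + 1) (i + 1 + 1) ≫ h = g := by
    intro i
    rw [HomologicalComplex.exactAt_iff' _ (i + 1 + 1) (i + 1) i
      (ComplexShape.prev_eq' _ (by simp)) (ComplexShape.next_eq' _ (by simp)),
      ShortComplex.ab_exact_iff]
    rfl
  constructor
  · intro h i
    exact (key i).1 (h _)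
  · intro h j
    obtain ⟨i, rfl⟩ : ∃ i, j = i + 1 := ⟨j - 1, by lia⟩
    exact (key i).2 (h i)

/-- The short exact sequences are spliced: each differential is the epimorphism `g i` followed by
the monomorphism `f (i + 1)`. A map from `P (i + 1)` to `L` killed by the differential factors
through `K (i + 2)`, and the extension property there makes it a coboundary. -/
theorem isGorensteinProjectiveFor_of_chain {𝓛 : C → Prop} (K : ℤ → C)
    (hK : ∀ i, SyzygyRel 𝓛 (K i) (K (i + 1))) {X : C} (e : X ≅ K 0) :
    IsGorensteinProjectiveFor 𝓛 X := by
  choose P f g w hP hS hL using hK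
  have hf (i) : Mono (f i) := (hS i).mono_f
  have hg (i) : Epi (g i) := (hS i).epi_g
  have hw (i) : (g i ≫ f (i + 1)) ≫ g (i + 1) ≫ f (i + 1 + 1) = 0 := by
    rw [Category.assoc, reassoc_of% (w (i + 1)), zero_comp, comp_zero]
  let Q : CochainComplex C ℤ := CochainComplex.of P (fun i => g i ≫ f (i + 1)) hw
  have hd (i) : Q.d i (i + 1) = g i ≫ f (i + 1) := CochainComplex.of_d P (fun i => g i ≫ f (i + 1)) i
  refine ⟨Q, hP, ?_, ⟨?_⟩, ?_⟩
  · intro j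
    obtain ⟨i, rfl⟩ : ∃ i, j = i + 1 := ⟨j - 1, by lia⟩
    rw [HomologicalComplex.exactAt_iff' _ i (i + 1) (i + 1 + 1)
      (ComplexShape.prev_eq' _ (by simp)) (ComplexShape.next_eq' _ (by simp))]
    have h : (ShortComplex.mk (g i ≫ f (i + 1)) (g (i + 1) ≫ f (i + 1 + 1)) (hw i)).Exact := by
      rw [ShortComplex.exact_iff_exact_up_to_refinements]
      intro A x hx
      have hx' : x ≫ g (i + 1) = 0 := by
        rw [← cancel_mono (f (i + 1 + 1)), zero_comp, Category.assoc]
        exact hx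
      let y : A ⟶ K (i + 1) := (hS (i + 1)).exact.lift x hx'
      have hy : y ≫ f (i + 1) = x := (hS (i + 1)).exact.lift_f x hx'
      refine ⟨pullback y (g i), pullback.fst _ _, inferInstance, pullback.snd _ _, ?_⟩
      change _ = pullback.snd _ _ ≫ g i ≫ f (i + 1)
      rw [← pullback.condition_assoc, hy]
    let e : ShortComplex.mk _ _ (hw i) ≅ Q.sc' i (i + 1) (i + 1 + 1) :=
      ShortComplex.isoMk (Iso.refl (P i)) (Iso.refl (P (i + 1))) (Iso.refl (P (i + 1 + 1)))
        ((Category.id_comp _).trans ((hd i).trans (Category.comp_id (g i ≫ f (i + 1))).symm))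
        ((Category.id_comp _).trans ((hd (i + 1)).trans
          (Category.comp_id (g (i + 1) ≫ f (i + 1 + 1))).symm))
    exact ShortComplex.exact_of_iso e h
  · have h0 : Q.d 0 1 = g 0 ≫ f (0 + 1) := hd 0
    have := hS 0
    have hk : IsLimit (KernelFork.ofι (f := Q.d 0 1) (f 0)
        (by rw [h0, reassoc_of% (w 0), zero_comp])) :=
      KernelFork.IsLimit.ofι' _ _ fun {A} x hx => by
        have hx' : x ≫ g 0 = 0 := by
          rw [← cancel_mono (f (0 + 1)), zero_comp, Category.assoc, ← h0]
          exact hx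
        exact ⟨(hS 0).exact.lift x hx', (hS 0).exact.lift_f x hx'⟩
    exact e ≪≫ hk.conePointUniqueUpToIso (limit.isLimit _)
  · intro L hLL
    rw [yoneda_acyclic_iff]
    intro i u hu
    rw [hd, Category.assoc] at hu
    have hu' : f (i + 1) ≫ u = 0 := by
      rw [← cancel_epi (g i), comp_zero]
      exact hu
    obtain ⟨v, hv⟩ : ∃ v : K (i + 1 + 1) ⟶ L, g (i + 1) ≫ v = u :=
      ⟨(hS (i + 1)).exact.desc u hu', (hS (i + 1)).exact.g_desc u hu'⟩
    obtain ⟨h, hh⟩ := hL (i + 1 + 1) L hLL v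
    refine ⟨h, ?_⟩
    rw [hd, Category.assoc, hh, hv]

theorem IsGorensteinProjectiveFor.exists_chain {𝓛 : C → Prop} {X : C}
    (hX : IsGorensteinProjectiveFor 𝓛 X) :
    ∃ K : ℤ → C, (∀ i, SyzygyRel 𝓛 (K i) (K (i + 1))) ∧ Nonempty (X ≅ K 0) := by
  obtain ⟨P, hP, hex, he, hL⟩ := hX
  have hepi (i : ℤ) :
      Epi (kernel.lift (P.d (i + 1) (i + 1 + 1)) (P.d i (i + 1)) (P.d_comp_d _ _ _)) := by
    have h := hex (i + 1)
    rw [HomologicalComplex.exactAt_iff' _ i (i + 1) (i + 1 + 1)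
      (ComplexShape.prev_eq' _ (by simp)) (ComplexShape.next_eq' _ (by simp))] at h
    exact h.epi_kernelLift
  refine ⟨fun i => kernel (P.d i (i + 1)), fun i => ?_, by simpa using he⟩
  refine ⟨P.X i, kernel.ι _, kernel.lift _ (P.d i (i + 1)) (P.d_comp_d _ _ _), ?_, hP i, ?_, ?_⟩
  · rw [← cancel_mono (kernel.ι _), Category.assoc, kernel.lift_ι, kernel.condition, zero_comp]
  · have := hepi i
    refine ⟨?_⟩
    rw [ShortComplex.exact_iff_exact_up_to_refinements]
    intro A x hx
    have hx' : x ≫ P.d i (i + 1) = 0 := by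
      have := congrArg (· ≫ kernel.ι _) hx
      simpa using this
    exact ⟨A, 𝟙 _, inferInstance, kernel.lift _ x hx', by simp⟩
  · intro L hLL u
    -- Two earlier terms of the complex are needed: `u` is pulled back along the epimorphism `q`
    -- from the preceding term to a cocycle, and exactness of `Hom(P, L)` writes it as a coboundary.
    -- Cancelling `q` gives the extension.
    obtain ⟨j, rfl⟩ : ∃ j, i = j + 1 := ⟨i - 1, by lia⟩
    have := hepi j
    obtain ⟨k, rfl⟩ : ∃ k, j = k + 1 := ⟨j - 1, by lia⟩
    let q : P.X (k + 1) ⟶ kernel (P.d (k + 1 + 1) (k + 1 + 1 + 1)) :=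
      kernel.lift _ (P.d (k + 1) (k + 1 + 1)) (P.d_comp_d _ _ _)
    have hq : P.d k (k + 1) ≫ q = 0 := by
      rw [← cancel_mono (kernel.ι _), Category.assoc, kernel.lift_ι, P.d_comp_d, zero_comp]
    obtain ⟨h, hh⟩ := (yoneda_acyclic_iff P L).1 (hL L hLL) k (q ≫ u)
      (by rw [reassoc_of% hq, zero_comp])
    refine ⟨h, ?_⟩
    rw [← cancel_epi q, ← hh, ← Category.assoc, kernel.lift_ι]

/-- The cokernel of a morphism of short exact sequences which is a monomorphism on the right is
short exact. -/
theorem shortExact_cokernel {S₁ S₂ : ShortComplex C} (φ : S₁ ⟶ S₂) (h₁ : S₁.ShortExact)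
    (h₂ : S₂.ShortExact) [Mono φ.τ₃] : (cokernel φ).ShortExact := by
  have := h₁.epi_g
  have := h₂.mono_f
  have := h₂.epi_g
  let D : ShortComplex.SnakeInput C :=
    { L₀ := kernel φ
      L₁ := S₁
      L₂ := S₂
      L₃ := cokernel φ
      v₀₁ := kernel.ι φ
      v₁₂ := φ
      v₂₃ := cokernel.π φ
      w₀₂ := kernel.condition φ
      w₁₃ := cokernel.condition φ
      h₀ := kernelIsKernel φ
      h₃ := cokernelIsCokernel φ
      L₁_exact := h₁.exact
      epi_L₁_g := inferInstance
      L₂_exact := h₂.exact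
      mono_L₂_f := inferInstance }
  have := D.mono_v₀₁_τ₃
  have : Epi D.L₂.g := h₂.epi_g
  -- This is the source of the connecting map of the snake; once it is zero, the left map of the
  -- cokernel sequence is mono.
  have h0 : IsZero D.L₀.X₃ := by
    rw [IsZero.iff_id_eq_zero, ← cancel_mono (show D.L₀.X₃ ⟶ D.L₁.X₃ from D.v₀₁.τ₃),
      ← cancel_mono φ.τ₃, Category.id_comp, zero_comp, zero_comp]
    exact D.w₀₂_τ₃
  have : Mono D.L₃.f := D.L₂'_exact.mono_g (h0.eq_of_src _ _)
  have : Epi D.L₃.g := D.epi_L₃_g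
  exact { exact := D.L₃_exact, mono_f := ‹_›, epi_g := ‹_› }

theorem IsGorensteinProjectiveFor.of_iso {𝓛 : C → Prop} {X Y : C} (e : X ≅ Y)
    (hX : IsGorensteinProjectiveFor 𝓛 X) : IsGorensteinProjectiveFor 𝓛 Y := by
  obtain ⟨P, hP, hex, ⟨e'⟩, hL⟩ := hX
  exact ⟨P, hP, hex, ⟨e.symm ≪≫ e'⟩, hL⟩

/-- The third term of a short exact sequence is a cokernel. -/
noncomputable def cokernelIsoOfShortExact {S : ShortComplex C} (hS : S.ShortExact) :
    cokernel S.f ≅ S.X₃ :=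
  (cokernelIsCokernel S.f).coconePointUniqueUpToIso hS.gIsCokernel

theorem IsGorensteinProjectiveFor.exists_syzygyRel {𝓛 : C → Prop} {X : C}
    (hX : IsGorensteinProjectiveFor 𝓛 X) :
    ∃ Y, SyzygyRel 𝓛 X Y ∧ IsGorensteinProjectiveFor 𝓛 Y := by
  obtain ⟨K, hK, ⟨e⟩⟩ := hX.exists_chain
  obtain ⟨P, f, g, w, hP, hS, hL⟩ := hK 0
  refine ⟨K (0 + 1), ⟨P, e.hom ≫ f, g, by rw [Category.assoc, w, comp_zero], hP, ?_, ?_⟩, ?_⟩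
  · exact ShortComplex.shortExact_of_iso (S₁ := ShortComplex.mk f g w)
      (ShortComplex.isoMk e.symm (Iso.refl _) (Iso.refl _) (by simp) (by simp)) hS
  · intro L hLL u
    obtain ⟨v, hv⟩ := hL L hLL (e.inv ≫ u)
    exact ⟨v, by rw [Category.assoc, hv, e.hom_inv_id_assoc]⟩
  · exact isGorensteinProjectiveFor_of_chain (fun i => K (i + 1)) (fun i => hK (i + 1))
      (Iso.refl _)

/-- A relation that can be continued to the right on a class `S` and to the left on a larger
class has bi-infinite chains through every member of `S`. -/
theorem exists_int_chain {α : Type*} (r : α → α → Prop) (S T : α → Prop) (hST : ∀ a, S a → T a)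
    (hS : ∀ a, S a → ∃ b, r a b ∧ S b) (hT : ∀ b, T b → ∃ a, r a b ∧ T a) (a : α) (ha : S a) :
    ∃ K : ℤ → α, (∀ i, r (K i) (K (i + 1))) ∧ K 0 = a := by
  choose! next hnext hSnext using hS
  choose! prev hprev hTprev using hT
  have hn (n : ℕ) : S (next^[n] a) := by
    induction n with
    | zero => exact ha
    | succ n ih => rw [Function.iterate_succ_apply']; exact hSnext _ ih
  have hp (n : ℕ) : T (prev^[n] a) := by
    induction n with
    | zero => exact hST _ ha
    | succ n ih => rw [Function.iterate_succ_apply']; exact hTprev _ ih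
  refine ⟨fun i => match i with
    | Int.ofNat n => next^[n] a
    | Int.negSucc n => prev^[n + 1] a, fun i => ?_, rfl⟩
  rcases i with n | n
  · change r (next^[n] a) (next^[n + 1] a)
    rw [Function.iterate_succ_apply']
    exact hnext _ (hn n)
  · rcases n with _ | n
    · exact hprev _ (hp 0)
    · change r (prev^[n + 1 + 1] a) (prev^[n + 1] a)
      rw [Function.iterate_succ_apply' _ (n + 1)]
      exact hprev _ (hp (n + 1))

/-- The two classes differ on purpose: `T` can be an Ext-vanishing condition, stable under kernels
of projective presentations, whereas continuing to the right needs the stronger condition `S`. -/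
theorem isGorensteinProjectiveFor_of_classes {𝓛 : C → Prop} (S T : C → Prop)
    (hST : ∀ X, S X → T X) (hS : ∀ X, S X → ∃ Y, SyzygyRel 𝓛 X Y ∧ S Y)
    (hT : ∀ X, T X → ∃ Y, SyzygyRel 𝓛 Y X ∧ T Y) {X : C} (hX : S X) :
    IsGorensteinProjectiveFor 𝓛 X := by
  obtain ⟨K, hK, rfl⟩ := exists_int_chain (SyzygyRel 𝓛) S T hST hS hT X hX
  exact isGorensteinProjectiveFor_of_chain K hK (Iso.refl _)

/-! ### Ext vanishing and closure under extensions. -/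

section Ext

open Abelian

variable [HasExt.{v} C]

/-- The positive Ext groups from `M` to all objects in the class `𝓛` vanish. -/
def ExtVanishing (𝓛 : C → Prop) (M : C) : Prop :=
  ∀ L, 𝓛 L → ∀ (n : ℕ) (x : Ext M L (n + 1)), x = 0

theorem extend_of_ext_eq_zero {S : ShortComplex C} (hS : S.ShortExact) {L : C}
    (h : ∀ x : Ext S.X₃ L 1, x = 0) (u : S.X₁ ⟶ L) : ∃ v : S.X₂ ⟶ L, S.f ≫ v = u := by
  obtain ⟨x, hx⟩ := Ext.contravariant_sequence_exact₁ hS L (Ext.mk₀ u) (add_zero 1) (h _)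
  obtain ⟨v, rfl⟩ := (Ext.mk₀_bijective _ _).2 x
  rw [Ext.mk₀_comp_mk₀] at hx
  exact ⟨v, (Ext.mk₀_bijective _ _).1 hx⟩

theorem ext_eq_zero_of_shortExact {S : ShortComplex C} (hS : S.ShortExact) {L : C} {n : ℕ}
    (h₁ : ∀ x : Ext S.X₁ L n, x = 0) (h₃ : ∀ x : Ext S.X₃ L n, x = 0) (x : Ext S.X₂ L n) :
    x = 0 := by
  obtain ⟨y, rfl⟩ := Ext.contravariant_sequence_exact₂ hS L x (h₁ _)
  rw [h₃ y, Ext.comp_zero]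

theorem ExtVanishing.of_projective (𝓛 : C → Prop) (P : C) [Projective P] : ExtVanishing 𝓛 P :=
  fun _ _ _ _ => Ext.eq_zero_of_projective _

theorem ExtVanishing.of_shortExact {𝓛 : C → Prop} {S : ShortComplex C} (hS : S.ShortExact)
    (h₁ : ExtVanishing 𝓛 S.X₁) (h₃ : ExtVanishing 𝓛 S.X₃) : ExtVanishing 𝓛 S.X₂ :=
  fun L hL n => ext_eq_zero_of_shortExact hS (h₁ L hL n) (h₃ L hL n)

/-- `Ext^{n+1}(S.X₁, L)` lies between `Ext^{n+1}(S.X₂, L)` and `Ext^{n+2}(S.X₃, L)`; this is why all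
positive degrees are kept in `ExtVanishing`. -/
theorem ExtVanishing.of_epi {𝓛 : C → Prop} {S : ShortComplex C} (hS : S.ShortExact)
    (h₂ : ExtVanishing 𝓛 S.X₂) (h₃ : ExtVanishing 𝓛 S.X₃) : ExtVanishing 𝓛 S.X₁ := by
  intro L hL n x
  obtain ⟨y, rfl⟩ := Ext.contravariant_sequence_exact₁ hS L x (Nat.add_comm _ _) (h₃ L hL _ _)
  rw [h₂ L hL n y, Ext.comp_zero]

theorem ext_one_eq_zero_of_extend {S : ShortComplex C} (hS : S.ShortExact) [Projective S.X₂]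
    {L : C} (h : ∀ u : S.X₁ ⟶ L, ∃ v : S.X₂ ⟶ L, S.f ≫ v = u) (x : Ext S.X₃ L 1) : x = 0 := by
  obtain ⟨y, rfl⟩ := Ext.contravariant_sequence_exact₃ hS L x (Ext.eq_zero_of_projective _)
    (add_zero 1)
  obtain ⟨u, rfl⟩ := (Ext.mk₀_bijective _ _).2 y
  obtain ⟨v, rfl⟩ := h u
  rw [← Ext.mk₀_comp_mk₀, hS.extClass_comp_assoc]

theorem IsGorensteinProjectiveFor.extVanishing {𝓛 : C → Prop} {X : C}
    (hX : IsGorensteinProjectiveFor 𝓛 X) : ExtVanishing 𝓛 X := by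
  obtain ⟨K, hK, ⟨e⟩⟩ := hX.exists_chain
  -- Dimension shifting lowers the degree while moving one step left in the chain, so the induction
  -- must cover all `i` at once. The extension property is the case of degree one.
  suffices h : ∀ (n : ℕ) (i : ℤ) (L : C), 𝓛 L → ∀ x : Ext (K (i + 1)) L (n + 1), x = 0 by
    intro L hL n x
    have h0 := h n (-1) L hL <|
      show Abelian.Ext (K (-1 + 1)) L (n + 1) from (Ext.mk₀ e.inv).comp x (zero_add _)
    have : x = (Ext.mk₀ e.hom).comp ((Ext.mk₀ e.inv).comp x (zero_add _)) (zero_add _) := by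
      rw [Ext.mk₀_comp_mk₀_assoc, e.hom_inv_id, Ext.mk₀_id_comp]
    rw [this]
    exact (congrArg (fun t => (Ext.mk₀ e.hom).comp t (zero_add (n + 1))) h0).trans
      (Ext.comp_zero _ _ _ _ _)
  intro n
  induction n with
  | zero =>
    intro i L hL x
    obtain ⟨P, f, g, w, hP, hS, hext⟩ := hK i
    exact ext_one_eq_zero_of_extend hS (hext L hL) x
  | succ n ih =>
    intro i L hL x
    obtain ⟨j, rfl⟩ : ∃ j, i = j + 1 := ⟨i - 1, by lia⟩
    obtain ⟨P, f, g, w, hP, hS, hext⟩ := hK (j + 1)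
    obtain ⟨y, rfl⟩ := Ext.contravariant_sequence_exact₃ hS L x (Ext.eq_zero_of_projective _)
      (Nat.add_comm 1 (n + 1))
    rw [ih j L hL y, Ext.comp_zero]

theorem exists_syzygyRel_of_extVanishing [EnoughProjectives C] {𝓛 : C → Prop} {X : C}
    (hX : ExtVanishing 𝓛 X) : ∃ Y, SyzygyRel 𝓛 Y X ∧ ExtVanishing 𝓛 Y := by
  have hS : (ShortComplex.mk _ _ (kernel.condition (Projective.π X))).ShortExact :=
    { exact := ShortComplex.exact_of_f_is_kernel _ (kernelIsKernel _) }
  exact ⟨_, ⟨_, _, _, _, inferInstance, hS, fun L hL =>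
    extend_of_ext_eq_zero hS (hX L hL 0)⟩, ExtVanishing.of_epi hS (.of_projective _ _) hX⟩

/-- If the class `𝓛` contains all projective objects, then the Gorenstein projective objects
relative to `𝓛` are closed under extensions. -/
theorem IsGorensteinProjectiveFor.of_shortExact [EnoughProjectives C] {𝓛 : C → Prop}
    (h𝓛 : ∀ P, Projective P → 𝓛 P) {S : ShortComplex C} (hS : S.ShortExact)
    (h₁ : IsGorensteinProjectiveFor 𝓛 S.X₁) (h₃ : IsGorensteinProjectiveFor 𝓛 S.X₃) :
    IsGorensteinProjectiveFor 𝓛 S.X₂ := by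
  let E : C → Prop := fun X => ∃ T : ShortComplex C, T.ShortExact ∧ T.X₂ = X ∧
    IsGorensteinProjectiveFor 𝓛 T.X₁ ∧ IsGorensteinProjectiveFor 𝓛 T.X₃
  refine isGorensteinProjectiveFor_of_classes E (ExtVanishing 𝓛) ?_ ?_
    (fun _ => exists_syzygyRel_of_extVanishing) (X := S.X₂) ⟨S, hS, rfl, h₁, h₃⟩
  · rintro _ ⟨T, hT, rfl, h₁, h₃⟩
    exact .of_shortExact hT h₁.extVanishing h₃.extVanishing
  · rintro _ ⟨T, hT, rfl, h₁, h₃⟩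
    obtain ⟨A', ⟨P, f, g, w, hP, hfg, hL⟩, hA'⟩ := h₁.exists_syzygyRel
    obtain ⟨B', ⟨Q, f', g', w', hQ, hfg', hL'⟩, hB'⟩ := h₃.exists_syzygyRel
    -- Horseshoe argument on the injective side: `P` is not injective, but it lies in `𝓛`, so
    -- `Ext¹(T.X₃, P) = 0` and `f` extends over `T.X₂`.
    obtain ⟨φ, hφ⟩ := extend_of_ext_eq_zero hT (h₃.extVanishing P (h𝓛 P hP) 0) f
    have := hfg.mono_f
    have := hfg'.mono_f
    have := hT.mono_f
    let U : ShortComplex C := ShortComplex.mk (biprod.inl : P ⟶ P ⊞ Q) biprod.snd (by simp)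
    have hU : U.ShortExact := (ShortComplex.Splitting.ofHasBinaryBiproduct P Q).shortExact
    let ψ : T ⟶ U :=
      { τ₁ := f
        τ₂ := biprod.lift φ (T.g ≫ f')
        τ₃ := f'
        comm₁₂ := by
          apply biprod.hom_ext
          · simp [U, hφ]
          · simp [U]
        comm₂₃ := by simp [U] }
    have : Mono ψ.τ₁ := ‹Mono f›
    have : Mono ψ.τ₃ := ‹Mono f'›
    -- The cokernel sequence again has Gorenstein projective ends, so its middle term is in `E` and
    -- the rightward chain can continue.
    have hc := shortExact_cokernel ψ hT hU
    have : Mono ψ.τ₂ := ShortComplex.mono_τ₂_of_exact_of_mono ψ hT.exact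
    have hD : (ShortComplex.mk ψ.τ₂ ((cokernel.π ψ).τ₂)
        (congrArg ShortComplex.Hom.τ₂ (cokernel.condition ψ))).ShortExact :=
      { exact := ShortComplex.exact_of_g_is_cokernel _ (isColimitCoforkMapOfIsColimit'
          ShortComplex.π₂ (cokernel.condition ψ) (cokernelIsCokernel ψ))
        epi_g := (inferInstance : Epi (ShortComplex.π₂.map (cokernel.π ψ))) }
    have hA : IsGorensteinProjectiveFor 𝓛 (cokernel ψ).X₁ :=
      hA'.of_iso ((PreservesCokernel.iso ShortComplex.π₁ ψ ≪≫ cokernelIsoOfShortExact hfg).symm)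
    have hB : IsGorensteinProjectiveFor 𝓛 (cokernel ψ).X₃ :=
      hB'.of_iso ((PreservesCokernel.iso ShortComplex.π₃ ψ ≪≫ cokernelIsoOfShortExact hfg').symm)
    have hv : ExtVanishing 𝓛 (cokernel ψ).X₂ := .of_shortExact hc hA.extVanishing hB.extVanishing
    exact ⟨(cokernel ψ).X₂, ⟨P ⊞ Q, ψ.τ₂, (cokernel.π ψ).τ₂, _, inferInstance, hD,
      fun L hL => extend_of_ext_eq_zero hD (hv L hL 0)⟩, cokernel ψ, hc, rfl, hA, hB⟩

end Ext

end Abstract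

end GorensteinAC

namespace GorensteinAC

/-! ### First derived functors, and levelness of projective modules. -/

section DerivedFunctors

variable {C D : Type*} [Category* C] [Category* D] [Abelian C] [Abelian D]

theorem isZero_leftDerived_one_iff [EnoughProjectives C] (F : C ⥤ D) [F.Additive] {X : C}
    (P : ProjectiveResolution X) :
    IsZero ((F.leftDerived 1).obj X) ↔ (P.complex.sc' 2 1 0 |>.map F).Exact := by
  rw [(P.isoLeftDerivedObj F 1).isZero_iff]
  change IsZero (((F.mapHomologicalComplex _).obj P.complex).homology 1) ↔ _
  rw [← HomologicalComplex.exactAt_iff_isZero_homology,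
    HomologicalComplex.exactAt_iff' _ 2 1 0 (by simp) (by simp)]
  rfl

theorem ProjectiveResolution.sc'_exact {X : C} (P : ProjectiveResolution X) :
    (P.complex.sc' 2 1 0).Exact := by
  have := P.complex_exactAt_succ 0
  rwa [HomologicalComplex.exactAt_iff' _ 2 1 0 (by simp) (by simp)] at this

theorem exact_map_iff_of_iso {S : ShortComplex C} {F G : C ⥤ D} [F.PreservesZeroMorphisms]
    [G.PreservesZeroMorphisms] (e : F ≅ G) : (S.map F).Exact ↔ (S.map G).Exact :=
  ShortComplex.exact_iff_of_iso (S.mapNatIso e)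

end DerivedFunctors

variable {R : Type u} [Ring R]

namespace BalancedTensor

variable {M N : Type u} [AddCommGroup M] [Module Rᵐᵒᵖ M] [AddCommGroup N] [Module R N]

/-- Additive maps out of `M ⊗_R N` from balanced biadditive maps. -/
def lift {A : Type*} [AddCommGroup A] (φ : M →+ N →+ A)
    (h : ∀ (m : M) (r : R) (n : N), φ (MulOpposite.op r • m) n = φ m (r • n)) :
    BalancedTensor R M N →+ A :=
  QuotientAddGroup.lift _ (TensorProduct.liftAddHom φ (fun z m n => by simp)) (by
    refine (AddSubgroup.closure_le _).2 ?_
    rintro _ ⟨m, r, n, rfl⟩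
    change _ = _
    rw [map_sub, TensorProduct.liftAddHom_tmul, TensorProduct.liftAddHom_tmul, h, sub_self])

theorem tmul_zero (m : M) : tmul R m (0 : N) = 0 :=
  congrArg QuotientAddGroup.mk (TensorProduct.tmul_zero _ m)

theorem zero_tmul (n : N) : tmul R (0 : M) n = 0 :=
  congrArg QuotientAddGroup.mk (TensorProduct.zero_tmul _ n)

/-- The map `(N →₀ M) → M ⊗_R N` which sends a finite family `(m_n)` to `∑ m_n ⊗ n`. -/
noncomputable def ofFinsupp : (N →₀ M) →+ BalancedTensor R M N :=
  Finsupp.liftAddHom fun n =>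
    { toFun := fun m => tmul R m n
      map_zero' := zero_tmul n
      map_add' := fun m m' => add_tmul m m' n }

@[simp]
theorem ofFinsupp_single (n : N) (m : M) :
    ofFinsupp (R := R) (Finsupp.single n m) = tmul R m n := by
  exact (Finsupp.liftAddHom_apply_single _ _ _)

/-- The map `m ⊗ n ↦ m · s(n)`, for a linear map `s : N → (N →₀ R)`. -/
noncomputable def toFinsupp (s : N →ₗ[R] (N →₀ R)) : BalancedTensor R M N →+ (N →₀ M) :=
  lift
    { toFun := fun m =>
        { toFun := fun n => (s n).mapRange (fun r => MulOpposite.op r • m) (by simp)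
          map_zero' := by ext; simp
          map_add' := fun n n' => by ext; simp [add_smul] }
      map_zero' := by ext; simp
      map_add' := fun m m' => by ext; simp }
    (fun m r n => by ext; simp [mul_smul])

theorem toFinsupp_tmul (s : N →ₗ[R] (N →₀ R)) (m : M) (n : N) :
    toFinsupp s (tmul R m n) = (s n).mapRange (fun r => MulOpposite.op r • m) (by simp) := rfl

/-- A section `s` of the canonical surjection from the free module on `N` makes `M ⊗ N` a retract of
the direct sum of copies of `M` indexed by `N`. Naturality of this retraction in `M` is
`map_ofFinsupp` and `toFinsupp_map`. -/
theorem ofFinsupp_toFinsupp (s : N →ₗ[R] (N →₀ R))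
    (hs : ∀ n, Finsupp.linearCombination R (id : N → N) (s n) = n) (t : BalancedTensor R M N) :
    ofFinsupp (R := R) (toFinsupp s t) = t := by
  have h (m : M) (c : N →₀ R) :
      ofFinsupp (R := R) (c.mapRange (fun r => MulOpposite.op r • m) (by simp)) =
        tmul R m (Finsupp.linearCombination R (id : N → N) c) := by
    induction c using Finsupp.induction_linear with
    | zero => simp [tmul_zero]
    | add c c' hc hc' =>
      rw [map_add, tmul_add, ← hc, ← hc', ← map_add]
      congr 1
      ext; simp [add_smul]
    | single n r => simp [smul_tmul]
  have h' : (ofFinsupp (R := R) (M := M) (N := N)).comp (toFinsupp s) = AddMonoidHom.id _ :=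
    hom_ext fun m n => by
      change ofFinsupp (R := R) (toFinsupp s (tmul R m n)) = tmul R m n
      rw [toFinsupp_tmul, h, hs]
  exact DFunLike.congr_fun h' t

theorem map_ofFinsupp {M' : Type u} [AddCommGroup M'] [Module Rᵐᵒᵖ M'] (f : M →ₗ[Rᵐᵒᵖ] M')
    (c : N →₀ M) : map f (LinearMap.id : N →ₗ[R] N) (ofFinsupp c) =
      ofFinsupp (c.mapRange f (map_zero f)) := by
  induction c using Finsupp.induction_linear with
  | zero => simp
  | add c c' hc hc' => rw [map_add, map_add, hc, hc', ← map_add, Finsupp.mapRange_add (map_add f)]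
  | single n m => simp

theorem toFinsupp_map {M' : Type u} [AddCommGroup M'] [Module Rᵐᵒᵖ M'] (f : M →ₗ[Rᵐᵒᵖ] M')
    (s : N →ₗ[R] (N →₀ R)) (t : BalancedTensor R M N) :
    toFinsupp s (map f (LinearMap.id : N →ₗ[R] N) t) =
      (toFinsupp s t).mapRange f (map_zero f) := by
  have h : (toFinsupp s).comp (map f (LinearMap.id : N →ₗ[R] N)) =
      (Finsupp.mapRange.addMonoidHom f.toAddMonoidHom).comp (toFinsupp s) :=
    hom_ext fun m n => by
      change toFinsupp s (tmul R (f m) n) =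
        (toFinsupp s (tmul R m n)).mapRange f (map_zero f)
      rw [toFinsupp_tmul, toFinsupp_tmul]
      ext; simp
  exact DFunLike.congr_fun h t

end BalancedTensor

/-- The functor is a retract of a direct sum of identity functors, so a preimage can be chosen
coordinate by coordinate. -/
theorem tensor_exact_of_projective (N : ModuleCat.{u} R) [Projective N]
    {S : ShortComplex (ModuleCat.{u} Rᵐᵒᵖ)} (hS : S.Exact) :
    (S.map ((tensorBifunctor R).flip.obj N)).Exact := by
  have : Module.Projective R N := (IsProjective.iff_projective N).2 inferInstance
  obtain ⟨s, hs⟩ := Module.projective_def'.1 this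
  have hs' (n : N) : Finsupp.linearCombination R (id : N → N) (s n) = n :=
    LinearMap.congr_fun hs n
  rw [ShortComplex.ab_exact_iff]
  intro (t : BalancedTensor R S.X₂ N)
    (ht : BalancedTensor.map S.g.hom (LinearMap.id : N →ₗ[R] N) t = 0)
  have h0 : (BalancedTensor.toFinsupp s t).mapRange S.g.hom (map_zero _) = 0 := by
    rw [← BalancedTensor.toFinsupp_map, ht, map_zero]
  rw [ShortComplex.moduleCat_exact_iff] at hS
  have hl (m : S.X₂) : ∃ l : S.X₁, S.g m = 0 → S.f l = m := by
    by_cases h : S.g m = 0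
    · obtain ⟨l, hl⟩ := hS m h
      exact ⟨l, fun _ => hl⟩
    · exact ⟨0, fun h' => (h h').elim⟩
  classical
  choose l hl using hl
  -- `Finsupp.mapRange` requires a function sending `0` to `0`, which an arbitrary choice of
  -- preimages need not do.
  let l' : S.X₂ → S.X₁ := Function.update l 0 0
  have hl' (m : S.X₂) (hm : S.g m = 0) : S.f (l' m) = m := by
    by_cases h : m = 0
    · subst h; simp [l']
    · simp only [l', Function.update_of_ne h]; exact hl m hm
  refine ⟨BalancedTensor.ofFinsupp
    ((BalancedTensor.toFinsupp s t).mapRange l' (by simp [l'])), ?_⟩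
  change BalancedTensor.map S.f.hom (LinearMap.id : N →ₗ[R] N) _ = t
  rw [BalancedTensor.map_ofFinsupp]
  conv_rhs => rw [← BalancedTensor.ofFinsupp_toFinsupp s hs' t]
  congr 1
  ext n
  exact hl' _ (DFunLike.congr_fun h0 n)

theorem isLevelModule_of_projective (N : ModuleCat.{u} R) [Projective N] : IsLevelModule N := by
  rintro M ⟨P, -⟩
  rw [isZero_leftDerived_one_iff _ P]
  exact tensor_exact_of_projective N (ProjectiveResolution.sc'_exact P)

/-! ### Generators and relations for the modified tensor product. -/

section ModifiedTensor

/-- The degree `n` part of the modified tensor product. -/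
noncomputable abbrev modifiedTensorDegree (L : ChainComplex (ModuleCat.{u} R) ℤ) (n : ℤ) :
    ChainComplex (ModuleCat.{u} Rᵐᵒᵖ) ℤ ⥤ AddCommGrpCat.{u} :=
  modifiedTensor R L ⋙ HomologicalComplex.eval _ _ n

/-- The map `x ⊗ y ↦ x ⊗ y` from `X_i ⊗ L_j` to the modified tensor product. -/
noncomputable def modifiedι (X : ChainComplex (ModuleCat.{u} Rᵐᵒᵖ) ℤ)
    (L : ChainComplex (ModuleCat.{u} R) ℤ) (i j n : ℤ) (h : i + j = n) :
    ((tensorBifunctor R).obj (X.X i)).obj (L.X j) ⟶ (modifiedTensorDegree L n).obj X :=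
  HomologicalComplex.ιMapBifunctor X L (tensorBifunctor R) (ComplexShape.down ℤ) i j n h ≫
    (tensorComplex X L).pOpcycles n

variable {X X' : ChainComplex (ModuleCat.{u} Rᵐᵒᵖ) ℤ} {L : ChainComplex (ModuleCat.{u} R) ℤ}

theorem modifiedTensor_hom_ext {n : ℤ} {A : AddCommGrpCat.{u}}
    {f g : (modifiedTensorDegree L n).obj X ⟶ A}
    (h : ∀ i j hij, modifiedι X L i j n hij ≫ f = modifiedι X L i j n hij ≫ g) : f = g := by
  refine (cancel_epi ((tensorComplex X L).pOpcycles n)).1 ?_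
  apply HomologicalComplex.mapBifunctor.hom_ext
  intro i j hij
  have := h i j hij
  exact (Category.assoc _ _ _).symm.trans (this.trans (Category.assoc _ _ _))

theorem modifiedι_naturality (f : X ⟶ X') (i j n : ℤ) (h : i + j = n) :
    modifiedι X L i j n h ≫ (modifiedTensorDegree L n).map f =
      ((tensorBifunctor R).map (f.f i)).app (L.X j) ≫ modifiedι X' L i j n h := by
  change (_ ≫ _) ≫ HomologicalComplex.opcyclesMap
    (HomologicalComplex.mapBifunctorMap f (𝟙 L) (tensorBifunctor R) (ComplexShape.down ℤ)) n = _
  rw [Category.assoc, HomologicalComplex.p_opcyclesMap, HomologicalComplex.ι_mapBifunctorMap_assoc]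
  rw [HomologicalComplex.id_f, CategoryTheory.Functor.map_id, Category.id_comp]
  rfl

theorem ι_d {i j i' j' n n' : ℤ} (hi : i' + 1 = i) (hj : j' + 1 = j) (hn : n' + 1 = n) (h : i + j = n) :
    HomologicalComplex.ιMapBifunctor X L (tensorBifunctor R) (ComplexShape.down ℤ) i j n h ≫
      (tensorComplex X L).d n n' =
    ((tensorBifunctor R).map (X.d i i')).app (L.X j) ≫
      HomologicalComplex.ιMapBifunctor X L (tensorBifunctor R) (ComplexShape.down ℤ) i' j n'
        (show i' + j = n' by lia) +
    i.negOnePow • ((tensorBifunctor R).obj (X.X i)).map (L.d j j') ≫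
      HomologicalComplex.ιMapBifunctor X L (tensorBifunctor R) (ComplexShape.down ℤ) i j' n'
        (show i + j' = n' by lia) := by
  rw [HomologicalComplex.mapBifunctor.d_eq, Preadditive.comp_add,
    HomologicalComplex.mapBifunctor.ι_D₁, HomologicalComplex.mapBifunctor.ι_D₂,
    HomologicalComplex.mapBifunctor.d₁_eq X L (tensorBifunctor R) _ (i₁ := i) (i₁' := i') hi j n'
      (show i' + j = n' by lia),
    HomologicalComplex.mapBifunctor.d₂_eq X L (tensorBifunctor R) _ i (i₂ := j) (i₂' := j') hj n'
      (show i + j' = n' by lia)]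
  congr 1
  exact one_smul _ _

/-- The boundary of `x ⊗ y` dies in the quotient. These are the defining relations, matching the
hypothesis of `modifiedDesc`. -/
theorem modifiedι_rel {i j i' j' n : ℤ} (hi : i' + 1 = i) (hj : j' + 1 = j) (h : i + j = n + 1) :
    ((tensorBifunctor R).map (X.d i i')).app (L.X j) ≫ modifiedι X L i' j n (by lia) +
      i.negOnePow • ((tensorBifunctor R).obj (X.X i)).map (L.d j j') ≫
        modifiedι X L i j' n (by lia) = 0 := by
  have := congrArg (· ≫ (tensorComplex X L).pOpcycles n) (ι_d (X := X) (L := L) hi hj rfl h)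
  simp only [Category.assoc, HomologicalComplex.d_pOpcycles, comp_zero, Preadditive.add_comp,
    Linear.units_smul_comp] at this
  exact this.symm

/-- Maps out of the modified tensor product. -/
noncomputable def modifiedDesc {n : ℤ} {A : AddCommGrpCat.{u}}
    (φ : ∀ i j : ℤ, i + j = n → (((tensorBifunctor R).obj (X.X i)).obj (L.X j) ⟶ A))
    (hφ : ∀ (i j i' j' : ℤ) (_ : i' + 1 = i) (_ : j' + 1 = j) (_ : i + j = n + 1),
      ((tensorBifunctor R).map (X.d i i')).app (L.X j) ≫ φ i' j (by lia) +
        i.negOnePow • ((tensorBifunctor R).obj (X.X i)).map (L.d j j') ≫ φ i j' (by lia) = 0) :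
    (modifiedTensorDegree L n).obj X ⟶ A :=
  (tensorComplex X L).descOpcycles
    (HomologicalComplex.mapBifunctorDesc (K₁ := X) (K₂ := L) (F := tensorBifunctor R)
      (c := ComplexShape.down ℤ) φ) (n + 1) (by simp) (by
    apply HomologicalComplex.mapBifunctor.hom_ext
    intro i j hij
    rw [← Category.assoc, ι_d (X := X) (L := L) (sub_add_cancel i 1) (sub_add_cancel j 1) rfl hij,
      Preadditive.add_comp, Linear.units_smul_comp, Category.assoc, Category.assoc,
      HomologicalComplex.ι_mapBifunctorDesc, HomologicalComplex.ι_mapBifunctorDesc, comp_zero]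
    exact hφ i j (i - 1) (j - 1) (sub_add_cancel i 1) (sub_add_cancel j 1) hij)

theorem modifiedι_desc {n : ℤ} {A : AddCommGrpCat.{u}}
    (φ : ∀ i j : ℤ, i + j = n → (((tensorBifunctor R).obj (X.X i)).obj (L.X j) ⟶ A))
    (hφ) (i j : ℤ) (h : i + j = n) : modifiedι X L i j n h ≫ modifiedDesc φ hφ = φ i j h := by
  refine (Category.assoc _ _ _).trans ?_
  refine (congrArg (_ ≫ ·) (HomologicalComplex.p_descOpcycles _ _ _ _ _)).trans ?_
  exact HomologicalComplex.ι_mapBifunctorDesc _ _ _ _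

/-- Exactness of complexes is tested degreewise, so levelness concerns the functors
`modifiedTensorDegree L n` one at a time and can be transported along natural isomorphisms of them.
-/
theorem isLevelComplex_iff (L : ChainComplex (ModuleCat.{u} R) ℤ) : IsLevelComplex L ↔
    ∀ (X : ChainComplex (ModuleCat.{u} Rᵐᵒᵖ) ℤ) (P : ProjectiveResolution X),
      (∀ i, IsFinitelyGeneratedComplex (P.complex.X i)) → ∀ n,
      ((P.complex.sc' 2 1 0).map (modifiedTensorDegree L n)).Exact := by
  constructor
  · intro h X P hP n
    have := h X ⟨P, hP⟩
    rw [isZero_leftDerived_one_iff _ P, HomologicalComplex.exact_iff_degreewise_exact] at this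
    exact this n
  · rintro h X ⟨P, hP⟩
    rw [isZero_leftDerived_one_iff _ P, HomologicalComplex.exact_iff_degreewise_exact]
    exact h X P hP

end ModifiedTensor

end GorensteinAC

namespace GorensteinAC

/-! ### Disks and their two adjunctions with evaluation. -/

section Disk

variable {S : Type u} [Ring S]

theorem sub_one_ne (k : ℤ) : k ≠ k - 1 := by lia

/-- The identification of the top degree of a disk. -/
noncomputable abbrev diskTop (M : ModuleCat.{u} S) (k : ℤ) : (disk M k).X k ≅ M :=
  HomologicalComplex.doubleXIso₀ _ _

/-- The identification of the bottom degree of a disk. -/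
noncomputable abbrev diskBot (M : ModuleCat.{u} S) (k : ℤ) : (disk M k).X (k - 1) ≅ M :=
  HomologicalComplex.doubleXIso₁ _ _ (sub_one_ne k)

theorem disk_d (M : ModuleCat.{u} S) (k : ℤ) :
    (disk M k).d k (k - 1) = (diskTop M k).hom ≫ (diskBot M k).inv := by
  refine (HomologicalComplex.double_d (𝟙 M) _ (sub_one_ne k)).trans ?_
  rw [Category.id_comp]

theorem isZero_disk_X (M : ModuleCat.{u} S) {k i : ℤ} (h₀ : i ≠ k) (h₁ : i ≠ k - 1) :
    IsZero ((disk M k).X i) :=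
  HomologicalComplex.isZero_double_X _ _ i h₀ h₁

open Classical in
/-- The chain map to a disk which is given by a map to its bottom degree. -/
noncomputable def toDisk {X : ChainComplex (ModuleCat.{u} S) ℤ} {N : ModuleCat.{u} S} {k : ℤ}
    (β : X.X (k - 1) ⟶ N) : X ⟶ disk N k where
  f i := if h : i = k then (X.XIsoOfEq h).hom ≫ X.d k (k - 1) ≫ β ≫ (diskTop N k).inv ≫
      ((disk N k).XIsoOfEq h).inv
    else if h' : i = k - 1 then (X.XIsoOfEq h').hom ≫ β ≫ (diskBot N k).inv ≫
      ((disk N k).XIsoOfEq h').inv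
    else 0
  comm' i j hij := by
    change j + 1 = i at hij
    by_cases hi : i = k
    · obtain rfl : j = k - 1 := by lia
      subst hi
      rw [dif_pos rfl, dif_neg (sub_one_ne _).symm, dif_pos rfl]
      simp [disk_d]
    · by_cases hj : j = k
      · subst hj
        simp only [dif_neg hi, dif_pos]
        rw [dif_neg (by lia), zero_comp]
        simp
      · by_cases hj' : j = k - 1
        · exact (hi (by lia)).elim
        · exact (isZero_disk_X N hj hj').eq_of_tgt _ _

theorem toDisk_f_bot {X : ChainComplex (ModuleCat.{u} S) ℤ} {N : ModuleCat.{u} S} {k : ℤ}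
    (β : X.X (k - 1) ⟶ N) : (toDisk β).f (k - 1) ≫ (diskBot N k).hom = β := by
  dsimp only [toDisk]
  rw [dif_neg (sub_one_ne _).symm, dif_pos rfl]
  simp

theorem toDisk_hom_ext {X : ChainComplex (ModuleCat.{u} S) ℤ} {N : ModuleCat.{u} S} {k : ℤ}
    {f g : X ⟶ disk N k} (h : f.f (k - 1) = g.f (k - 1)) : f = g := by
  refine HomologicalComplex.to_double_hom_ext ?_ h
  have hd : IsIso ((disk N k).d k (k - 1)) := by rw [disk_d]; infer_instance
  rw [← cancel_mono ((disk N k).d k (k - 1)), f.comm, g.comm, h]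

theorem toDisk_f_top {X : ChainComplex (ModuleCat.{u} S) ℤ} {N : ModuleCat.{u} S} {k : ℤ}
    (β : X.X (k - 1) ⟶ N) : (toDisk β).f k ≫ (diskTop N k).hom = X.d k (k - 1) ≫ β := by
  dsimp only [toDisk]
  rw [dif_pos rfl]
  simp

/-- The map of disks induced by a linear map. -/
noncomputable def diskMap {M M' : ModuleCat.{u} S} (f : M ⟶ M') (k : ℤ) :
    disk M k ⟶ disk M' k :=
  toDisk ((diskBot M k).hom ≫ f)

theorem diskMap_f_bot {M M' : ModuleCat.{u} S} (f : M ⟶ M') (k : ℤ) :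
    (diskMap f k).f (k - 1) ≫ (diskBot M' k).hom = (diskBot M k).hom ≫ f :=
  toDisk_f_bot _

theorem diskMap_f_top {M M' : ModuleCat.{u} S} (f : M ⟶ M') (k : ℤ) :
    (diskMap f k).f k ≫ (diskTop M' k).hom = (diskTop M k).hom ≫ f := by
  refine (toDisk_f_top _).trans ?_
  rw [disk_d]
  simp

theorem inv_diskMap_f_top {M M' : ModuleCat.{u} S} (f : M ⟶ M') (k : ℤ) :
    (diskTop M k).inv ≫ (diskMap f k).f k = f ≫ (diskTop M' k).inv := by
  rw [Iso.inv_comp_eq, ← Category.assoc, ← diskMap_f_top, Category.assoc, Iso.hom_inv_id,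
    Category.comp_id]

theorem toDisk_ext {X : ChainComplex (ModuleCat.{u} S) ℤ} {N : ModuleCat.{u} S} {k : ℤ}
    {f g : X ⟶ disk N k}
    (h : f.f (k - 1) ≫ (diskBot N k).hom = g.f (k - 1) ≫ (diskBot N k).hom) : f = g :=
  toDisk_hom_ext ((cancel_mono (diskBot N k).hom).1 h)

/-- The functor which sends a module to its `k`-disk. -/
noncomputable def diskFunctor (k : ℤ) : ModuleCat.{u} S ⥤ ChainComplex (ModuleCat.{u} S) ℤ where
  obj M := disk M k
  map f := diskMap f k
  map_id M := toDisk_ext (by rw [diskMap_f_bot]; simp)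
  map_comp f g := toDisk_ext (by
    rw [diskMap_f_bot, HomologicalComplex.comp_f, Category.assoc, diskMap_f_bot,
      reassoc_of% (diskMap_f_bot f k)])

/-- The disk functor is left adjoint to evaluation in the top degree of the disk. -/
noncomputable def diskAdjunction (k : ℤ) : diskFunctor (S := S) k ⊣
    HomologicalComplex.eval (ModuleCat.{u} S) (ComplexShape.down ℤ) k :=
  Adjunction.mkOfHomEquiv
    { homEquiv := fun M _ => (diskCorepresents M k).homEquiv
      homEquiv_naturality_left_symm := fun {M' M Y} f (g : M ⟶ Y.X k) => by
        have h : f ≫ g = (diskCorepresents M' k).homEquiv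
            (diskMap f k ≫ (diskCorepresents M k).homEquiv.symm g) := by
          have h1 : (diskTop M k).inv ≫ ((diskCorepresents M k).homEquiv.symm g).f k = g :=
            (diskCorepresents M k).homEquiv.apply_symm_apply g
          change _ = (diskTop M' k).inv ≫ ((diskMap f k).f k ≫
            ((diskCorepresents M k).homEquiv.symm g).f k)
          rw [← Category.assoc, inv_diskMap_f_top, Category.assoc, h1]
        exact ((diskCorepresents M' k).homEquiv.symm_apply_eq).2 h
      homEquiv_naturality_right := fun {M _ _} f g => (diskCorepresents M k).homEquiv_comp g f }

/-- Chain maps to a disk are the same as maps to its bottom degree. -/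
noncomputable def toDiskEquiv (X : ChainComplex (ModuleCat.{u} S) ℤ) (N : ModuleCat.{u} S)
    (k : ℤ) : (X.X (k - 1) ⟶ N) ≃ (X ⟶ disk N k) where
  toFun β := toDisk β
  invFun f := f.f (k - 1) ≫ (diskBot N k).hom
  left_inv β := toDisk_f_bot β
  right_inv _ := toDisk_ext (toDisk_f_bot _)

/-- The disk functor is right adjoint to evaluation in the bottom degree of the disk. -/
noncomputable def diskCoadjunction (k : ℤ) :
    HomologicalComplex.eval (ModuleCat.{u} S) (ComplexShape.down ℤ) (k - 1) ⊣
      diskFunctor (S := S) k :=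
  Adjunction.mkOfHomEquiv
    { homEquiv := fun X N => toDiskEquiv X N k
      homEquiv_naturality_left_symm := fun f g => Category.assoc (f.f (k - 1)) (g.f (k - 1)) _
      homEquiv_naturality_right := fun {X N N'} (f : X.X (k - 1) ⟶ N) (g : N ⟶ N') => by
        change toDisk (f ≫ g) = toDisk f ≫ diskMap g k
        apply toDisk_ext
        rw [toDisk_f_bot, HomologicalComplex.comp_f, Category.assoc, diskMap_f_bot,
          ← Category.assoc, toDisk_f_bot] }

instance (k : ℤ) : (diskFunctor (S := S) k).Additive := (diskAdjunction k).left_adjoint_additive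

instance (k : ℤ) : (diskFunctor (S := S) k).PreservesHomology := by
  have := (diskAdjunction (S := S) k).leftAdjoint_preservesColimits
  have := (diskCoadjunction (S := S) k).rightAdjoint_preservesLimits
  infer_instance

instance (k : ℤ) : (diskFunctor (S := S) k).PreservesProjectiveObjects where
  projective_obj {_} _ := projective_disk _ k

/-- Evaluation in degree `k - 1` is left adjoint to the disk functor, and the latter preserves
epimorphisms because it is itself a left adjoint. -/
theorem projective_eval (P : ChainComplex (ModuleCat.{u} S) ℤ) [Projective P] (n : ℤ) :
    Projective (P.X n) := by
  obtain ⟨k, rfl⟩ : ∃ k, n = k - 1 := ⟨n + 1, by lia⟩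
  have : PreservesColimitsOfSize.{0, 0} (diskFunctor (S := S) k) :=
    (diskAdjunction (S := S) k).leftAdjoint_preservesColimits
  exact (diskCoadjunction (S := S) k).map_projective P inferInstance

instance (n : ℤ) : (HomologicalComplex.eval (ModuleCat.{u} S)
    (ComplexShape.down ℤ) n).PreservesProjectiveObjects where
  projective_obj {P} _ := projective_eval P n

end Disk

/-! ### Finitely generated complexes. -/

section FinitelyGenerated

variable {S : Type u} [Ring S]

/-- Compactness is applied in the top degree only; the bottom degree is its image under the
differential, so the same finite subfamily works there. -/
theorem isFinitelyGeneratedComplex_disk (M : ModuleCat.{u} S) [Module.Finite S M] (k : ℤ) :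
    IsFinitelyGeneratedComplex (disk M k) := by
  intro I A hA hsum
  have hfin : Module.Finite S ((disk M k).X k) :=
    Module.Finite.equiv (diskTop M k).symm.toLinearEquiv
  obtain ⟨J, hJ⟩ := CompleteLattice.IsCompactElement.exists_finset_of_le_iSup _
    ((Submodule.fg_iff_compact _).1 hfin.fg_top) (fun i => A i k) (hsum k).ge
  refine ⟨J, fun n => ?_⟩
  by_cases h₀ : n = k
  · subst h₀
    exact top_le_iff.1 hJ
  by_cases h₁ : n = k - 1
  · subst h₁
    have hd : Function.Surjective ((disk M k).d k (k - 1)).hom := by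
      rw [← ModuleCat.epi_iff_surjective, disk_d]
      infer_instance
    rw [← top_le_iff, ← LinearMap.range_eq_top.2 hd, LinearMap.range_eq_map, ← top_le_iff.1 hJ,
      Submodule.map_iSup]
    refine iSup_mono fun i => ?_
    rw [Submodule.map_iSup]
    exact iSup_mono fun _ => hA i k (k - 1)
  · have := ModuleCat.subsingleton_of_isZero (isZero_disk_X M h₀ h₁)
    exact Subsingleton.elim _ _

theorem IsFinitelyGeneratedComplex.finite {X : ChainComplex (ModuleCat.{u} S) ℤ}
    (hX : IsFinitelyGeneratedComplex X) (n : ℤ) : Module.Finite S (X.X n) := by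
  classical
  -- `A p` is the subcomplex generated by one homogeneous element `x`: it is spanned by `x` and `d
  -- x`. Such subcomplexes sum to `X` and have finitely generated terms. The `ULift` puts the index
  -- type in universe `u`.
  let A (p : Σ j : ULift.{u} ℤ, X.X j.down) (n : ℤ) : Submodule S (X.X n) :=
    Submodule.span S ({y | ∃ h : p.1.down = n, (X.XIsoOfEq h).hom p.2 = y} ∪ {X.d p.1.down n p.2})
  obtain ⟨J, hJ⟩ := hX _ A (by
    rintro ⟨⟨j⟩, x⟩ n m
    refine (Submodule.map_span_le _ _ _).2 ?_
    rintro y (⟨h, rfl⟩ | rfl)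
    · dsimp at h
      subst h
      refine Submodule.subset_span (Or.inr ?_)
      simp
    · have : (X.d n m) ((X.d j n) x) = 0 := by
        rw [← ModuleCat.comp_apply, X.d_comp_d]; rfl
      exact this.symm ▸ Submodule.zero_mem _) (fun n => by
    rw [← top_le_iff]
    intro x _
    exact Submodule.mem_iSup_of_mem ⟨⟨n⟩, x⟩
      (Submodule.subset_span (Or.inl ⟨rfl, by simp⟩)))
  refine ⟨(hJ n).symm ▸ Submodule.fg_biSup J _ fun p _ => Submodule.fg_span ?_⟩
  refine Set.Finite.union (Set.Subsingleton.finite ?_) (Set.finite_singleton _)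
  rintro _ ⟨h, rfl⟩ _ ⟨h', rfl⟩
  rfl

end FinitelyGenerated
end GorensteinAC

namespace GorensteinAC

variable {R : Type u} [Ring R]

/-! ### Modified tensor products with disks. -/

section TensorDisk

/-- The map `(X ⊗̄ L)_n ⟶ M ⊗ L_j` which is induced by a map `β : X_{k-1} ⟶ M`, for `k + j = n`. -/
theorem exists_modifiedTensor_to_left {X : ChainComplex (ModuleCat.{u} Rᵐᵒᵖ) ℤ}
    (L : ChainComplex (ModuleCat.{u} R) ℤ) {k j n : ℤ} (h : k + j = n) {M : ModuleCat.{u} Rᵐᵒᵖ}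
    (β : X.X (k - 1) ⟶ M) :
    ∃ a : (modifiedTensorDegree L n).obj X ⟶ ((tensorBifunctor R).obj M).obj (L.X j),
      modifiedι X L k j n h ≫ a = ((tensorBifunctor R).map (X.d k (k - 1) ≫ β)).app (L.X j) := by
  classical
  let φ : ∀ p q : ℤ, p + q = n → (((tensorBifunctor R).obj (X.X p)).obj (L.X q) ⟶
      ((tensorBifunctor R).obj M).obj (L.X j)) := fun p q _ =>
    if h0 : q = j then ((tensorBifunctor R).map (X.d p (k - 1) ≫ β)).app (L.X q) ≫
        ((tensorBifunctor R).obj M).map (L.XIsoOfEq h0).hom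
    -- Here `q = j + 1`. The value and its sign are forced by vanishing on the boundary of `x ⊗ y`
    -- with `x` in degree `k` and `y` in degree `j + 1`.
    else if h1 : p = k - 1 then
      -(k.negOnePow • ((tensorBifunctor R).map ((X.XIsoOfEq h1).hom ≫ β)).app (L.X q) ≫
        ((tensorBifunctor R).obj M).map (L.d q j))
    else 0
  refine ⟨modifiedDesc φ ?_, ?_⟩
  · intro p q p' q' hp hq hpq
    dsimp only [φ]
    by_cases h0 : q = j
    · subst h0
      rw [dif_pos rfl, dif_neg (by lia), dif_neg (by lia), comp_zero, smul_zero, add_zero,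
        ← Category.assoc, ← NatTrans.comp_app, ← Functor.map_comp, X.d_comp_d_assoc, zero_comp,
        Functor.map_zero, zero_app, zero_comp]
    · rw [dif_neg h0]
      by_cases h1 : q' = j
      · subst h1
        obtain rfl : p = k := by lia
        obtain rfl : p' = p - 1 := by lia
        rw [dif_pos rfl, dif_pos rfl]
        simp
      · rw [dif_neg h1]
        by_cases h2 : p = k - 1
        · rw [dif_pos h2, dif_neg (by lia)]
          subst h2
          simp [← Functor.map_comp]
        · rw [dif_neg h2]
          by_cases h3 : p' = k - 1
          · exact (h1 (by lia)).elim
          · rw [dif_neg h3]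
            simp
  · rw [modifiedι_desc]
    dsimp only [φ]
    rw [dif_pos rfl]
    simp

theorem exists_modifiedTensor_to_right (X : ChainComplex (ModuleCat.{u} Rᵐᵒᵖ) ℤ)
    {L : ChainComplex (ModuleCat.{u} R) ℤ} {k i n : ℤ} (h : i + k = n) {N : ModuleCat.{u} R}
    (β : L.X (k - 1) ⟶ N) :
    ∃ a : (modifiedTensorDegree L n).obj X ⟶ ((tensorBifunctor R).obj (X.X i)).obj N,
      modifiedι X L i k n h ≫ a = ((tensorBifunctor R).obj (X.X i)).map (L.d k (k - 1) ≫ β) := by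
  classical
  let φ : ∀ p q : ℤ, p + q = n → (((tensorBifunctor R).obj (X.X p)).obj (L.X q) ⟶
      ((tensorBifunctor R).obj (X.X i)).obj N) := fun p q _ =>
    if h0 : p = i then ((tensorBifunctor R).map (X.XIsoOfEq h0).hom).app (L.X q) ≫
        ((tensorBifunctor R).obj (X.X i)).map (L.d q (k - 1) ≫ β)
    else if h1 : q = k - 1 then
      i.negOnePow • ((tensorBifunctor R).map (X.d p i)).app (L.X q) ≫
        ((tensorBifunctor R).obj (X.X i)).map ((L.XIsoOfEq h1).hom ≫ β)
    else 0
  refine ⟨modifiedDesc φ ?_, ?_⟩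
  · intro p q p' q' hp hq hpq
    dsimp only [φ]
    by_cases h0 : p = i
    · subst h0
      rw [dif_pos rfl, dif_neg (by lia), dif_neg (by lia), comp_zero, zero_add]
      simp [← Functor.map_comp]
    · rw [dif_neg h0]
      by_cases h1 : p' = i
      · subst h1
        obtain rfl : q = k := by lia
        obtain rfl : q' = q - 1 := by lia
        obtain rfl : p = p' + 1 := by lia
        rw [dif_pos rfl, dif_pos rfl]
        simp [Int.negOnePow_succ, smul_smul]
      · rw [dif_neg h1]
        by_cases h2 : q = k - 1
        · rw [dif_pos h2, dif_neg (by lia)]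
          subst h2
          simp [← NatTrans.comp_app_assoc, ← Functor.map_comp]
        · rw [dif_neg h2]
          by_cases h3 : q' = k - 1
          · exact (h1 (by lia)).elim
          · rw [dif_neg h3]
            simp
  · rw [modifiedι_desc]
    dsimp only [φ]
    rw [dif_pos rfl]
    simp

/-- The differential of the disk is invertible, so the relation `dx ⊗ y = -(-1)^k x ⊗ dy` expresses
the generators with `x` in the bottom degree through those in the top degree. The map built from
`diskBot` is the inverse. -/
theorem isIso_left_disk (M : ModuleCat.{u} Rᵐᵒᵖ) (L : ChainComplex (ModuleCat.{u} R) ℤ)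
    {k j n : ℤ} (h : k + j = n) :
    IsIso (((tensorBifunctor R).map (diskTop M k).inv).app (L.X j) ≫
      modifiedι (disk M k) L k j n h) := by
  obtain ⟨a, ha⟩ := exists_modifiedTensor_to_left L h (diskBot M k).hom
  refine ⟨a, ?_, ?_⟩
  · rw [Category.assoc, ha, ← NatTrans.comp_app, ← Functor.map_comp, disk_d]
    simp
  · have hk : modifiedι (disk M k) L k j n h ≫ a ≫
        ((tensorBifunctor R).map (diskTop M k).inv).app (L.X j) ≫
          modifiedι (disk M k) L k j n h = modifiedι (disk M k) L k j n h := by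
      rw [reassoc_of% ha, disk_d, ← NatTrans.comp_app_assoc, ← Functor.map_comp]
      simp
    apply modifiedTensor_hom_ext
    intro p q hpq
    rw [Category.comp_id]
    by_cases h0 : p = k
    · subst h0
      obtain rfl : q = j := by lia
      exact hk
    by_cases h1 : p = k - 1
    · subst h1
      have hrel := modifiedι_rel (X := disk M k) (L := L) (i := k) (i' := k - 1) (j := q)
        (j' := j) (n := n) (by lia) (by lia) (by lia)
      have : IsIso ((disk M k).d k (k - 1)) := by rw [disk_d]; infer_instance
      rw [← cancel_epi (((tensorBifunctor R).map ((disk M k).d k (k - 1))).app (L.X q)),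
        eq_neg_of_add_eq_zero_left hrel, ← Category.assoc, eq_neg_of_add_eq_zero_left hrel,
        Preadditive.neg_comp, Linear.units_smul_comp, Category.assoc, hk]
    · have : IsZero (((tensorBifunctor R).obj ((disk M k).X p)).obj (L.X q)) :=
        ((tensorBifunctor R).flip.obj (L.X q)).map_isZero (isZero_disk_X M h0 h1)
      exact this.eq_of_src _ _

theorem isIso_right_disk (X : ChainComplex (ModuleCat.{u} Rᵐᵒᵖ) ℤ) (N : ModuleCat.{u} R)
    {i k n : ℤ} (h : i + k = n) :
    IsIso (((tensorBifunctor R).obj (X.X i)).map (diskTop N k).inv ≫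
      modifiedι X (disk N k) i k n h) := by
  obtain ⟨a, ha⟩ := exists_modifiedTensor_to_right X h (diskBot N k).hom
  refine ⟨a, ?_, ?_⟩
  · rw [Category.assoc, ha, ← Functor.map_comp, disk_d]
    simp
  · have hk : modifiedι X (disk N k) i k n h ≫ a ≫
        ((tensorBifunctor R).obj (X.X i)).map (diskTop N k).inv ≫
          modifiedι X (disk N k) i k n h = modifiedι X (disk N k) i k n h := by
      rw [reassoc_of% ha, disk_d, ← Functor.map_comp_assoc]
      simp
    apply modifiedTensor_hom_ext
    intro p q hpq
    rw [Category.comp_id]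
    by_cases h0 : q = k
    · subst h0
      obtain rfl : p = i := by lia
      exact hk
    by_cases h1 : q = k - 1
    · subst h1
      have hrel := modifiedι_rel (X := X) (L := disk N k) (i := p) (i' := i) (j := k)
        (j' := k - 1) (n := n) (by lia) (by lia) (by lia)
      have : IsIso ((disk N k).d k (k - 1)) := by rw [disk_d]; infer_instance
      have hrel' : ((tensorBifunctor R).obj (X.X p)).map ((disk N k).d k (k - 1)) ≫
          modifiedι X (disk N k) p (k - 1) n hpq =
          p.negOnePow • -(((tensorBifunctor R).map (X.d p i)).app ((disk N k).X k) ≫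
            modifiedι X (disk N k) i k n h) := by
        rw [← eq_neg_of_add_eq_zero_right hrel, smul_smul, Int.units_mul_self, one_smul]
      rw [← cancel_epi (((tensorBifunctor R).obj (X.X p)).map ((disk N k).d k (k - 1))),
        hrel', ← Category.assoc, hrel', Linear.units_smul_comp,
        Preadditive.neg_comp, Category.assoc, hk]
    · have : IsZero (((tensorBifunctor R).obj (X.X p)).obj ((disk N k).X q)) :=
        ((tensorBifunctor R).obj (X.X p)).map_isZero (isZero_disk_X N h0 h1)
      exact this.eq_of_src _ _

/-- The degree `k + j` part of `D^k(M) ⊗̄ L` is `M ⊗ L_j`. -/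
noncomputable def leftDiskIso (L : ChainComplex (ModuleCat.{u} R) ℤ) {k j n : ℤ} (h : k + j = n) :
    (tensorBifunctor R).flip.obj (L.X j) ≅ diskFunctor k ⋙ modifiedTensorDegree L n :=
  NatIso.ofComponents (fun M => @asIso _ _ _ _ _ (isIso_left_disk M L h)) fun {M M'} f => by
    change ((tensorBifunctor R).map f).app (L.X j) ≫
      ((tensorBifunctor R).map (diskTop M' k).inv).app (L.X j) ≫ modifiedι (disk M' k) L k j n h =
      (((tensorBifunctor R).map (diskTop M k).inv).app (L.X j) ≫ modifiedι (disk M k) L k j n h) ≫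
        (modifiedTensorDegree L n).map (diskMap f k)
    rw [Category.assoc, modifiedι_naturality, ← NatTrans.comp_app_assoc, ← Functor.map_comp,
      ← inv_diskMap_f_top, Functor.map_comp, NatTrans.comp_app, Category.assoc]

/-- The degree `i + k` part of `X ⊗̄ D^k(N)` is `X_i ⊗ N`. -/
noncomputable def rightDiskIso (N : ModuleCat.{u} R) {i k n : ℤ} (h : i + k = n) :
    HomologicalComplex.eval _ _ i ⋙ (tensorBifunctor R).flip.obj N ≅
      modifiedTensorDegree (disk N k) n :=
  NatIso.ofComponents (fun X => @asIso _ _ _ _ _ (isIso_right_disk X N h)) fun {X X'} f => by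
    change ((tensorBifunctor R).map (f.f i)).app N ≫
      ((tensorBifunctor R).obj (X'.X i)).map (diskTop N k).inv ≫ modifiedι X' (disk N k) i k n h =
      (((tensorBifunctor R).obj (X.X i)).map (diskTop N k).inv ≫ modifiedι X (disk N k) i k n h) ≫
        (modifiedTensorDegree (disk N k) n).map f
    rw [Category.assoc, modifiedι_naturality, NatTrans.naturality_assoc]

/-- The disk functor is exact and carries a resolution of `M` by finitely generated projectives to
one of the disk on `M`; by `leftDiskIso` the two exactness conditions coincide. -/
theorem IsLevelComplex.isLevelModule {L : ChainComplex (ModuleCat.{u} R) ℤ}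
    (hL : IsLevelComplex L) (j : ℤ) : IsLevelModule (L.X j) := by
  rintro M ⟨P, hP⟩
  rw [isZero_leftDerived_one_iff _ P, exact_map_iff_of_iso (leftDiskIso L (zero_add j))]
  exact (isLevelComplex_iff L).1 hL _ ((diskFunctor 0).mapProjectiveResolution P)
    (fun i => have := hP i; isFinitelyGeneratedComplex_disk (P.complex.X i) 0) j

/-- The mirror image: evaluation carries resolutions of type `FP_∞` to such resolutions, and
`rightDiskIso` compares the tensor products. -/
theorem isLevelComplex_disk {N : ModuleCat.{u} R} (hN : IsLevelModule N) (k : ℤ) :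
    IsLevelComplex (disk N k) := by
  rw [isLevelComplex_iff]
  intro X P hP n
  rw [← exact_map_iff_of_iso (rightDiskIso N (sub_add_cancel n k))]
  exact (isZero_leftDerived_one_iff _ ((HomologicalComplex.eval _ _
    (n - k)).mapProjectiveResolution P)).1 (hN _
    ⟨(HomologicalComplex.eval _ _ (n - k)).mapProjectiveResolution P, fun i => (hP i).finite _⟩)

end TensorDisk

/-! ### Shifts of level complexes. -/

section Shift

/-- The shift of a complex, with `X_i = L_{i+s}` and differential `(-1)^s d`. -/
@[simps]
def shiftComplex {S : Type u} [Ring S] (L : ChainComplex (ModuleCat.{u} S) ℤ) (s : ℤ) :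
    ChainComplex (ModuleCat.{u} S) ℤ where
  X i := L.X (i + s)
  d i j := s.negOnePow • L.d (i + s) (j + s)
  shape i j h := by
    rw [L.shape _ _ (fun h' => h (by change j + s + 1 = i + s at h'; change j + 1 = i; lia)),
      smul_zero]
  d_comp_d' i j k _ _ := by simp

section

variable (X : ChainComplex (ModuleCat.{u} Rᵐᵒᵖ) ℤ) (L : ChainComplex (ModuleCat.{u} R) ℤ) (s : ℤ)

/-- The map from `X_i ⊗ L_{j+s}` to the modified tensor product with the shift of `L`. -/
noncomputable def shiftι (i j n : ℤ) (h : i + j = n) :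
    ((tensorBifunctor R).obj (X.X i)).obj (L.X (j + s)) ⟶
      (modifiedTensorDegree (shiftComplex L s) n).obj X :=
  modifiedι X (shiftComplex L s) i j n h

theorem map_shiftComplex_d (i j j' : ℤ) :
    ((tensorBifunctor R).obj (X.X i)).map ((shiftComplex L s).d j j') =
      s.negOnePow • ((tensorBifunctor R).obj (X.X i)).map (L.d (j + s) (j' + s)) :=
  Functor.map_units_smul _ _ _

theorem shiftι_rel {i j i' j' n : ℤ} (hi : i' + 1 = i) (hj : j' + 1 = j) (h : i + j = n + 1) :
    ((tensorBifunctor R).map (X.d i i')).app (L.X (j + s)) ≫ shiftι X L s i' j n (by lia) +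
      (i.negOnePow * s.negOnePow) • ((tensorBifunctor R).obj (X.X i)).map
        (L.d (j + s) (j' + s)) ≫ shiftι X L s i j' n (by lia) = 0 := by
  have hsm : s.negOnePow • ((tensorBifunctor R).obj (X.X i)).map (L.d (j + s) (j' + s)) ≫
      shiftι X L s i j' n (by lia) = (s.negOnePow • ((tensorBifunctor R).obj (X.X i)).map
        (L.d (j + s) (j' + s))) ≫ shiftι X L s i j' n (by lia) := by
    rw [Linear.units_smul_comp]
  rw [mul_smul, hsm]
  refine Eq.trans ?_ (modifiedι_rel (X := X) (L := shiftComplex L s) hi hj h)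
  rw [map_shiftComplex_d]
  rfl

variable {L s} in
theorem exists_shift_desc {n : ℤ} {A : AddCommGrpCat.{u}}
    (φ : ∀ i j : ℤ, i + j = n → (((tensorBifunctor R).obj (X.X i)).obj (L.X (j + s)) ⟶ A))
    (hφ : ∀ (i j i' j' : ℤ) (_ : i' + 1 = i) (_ : j' + 1 = j) (_ : i + j = n + 1),
      ((tensorBifunctor R).map (X.d i i')).app (L.X (j + s)) ≫ φ i' j (by lia) +
        (i.negOnePow * s.negOnePow) • ((tensorBifunctor R).obj (X.X i)).map
          (L.d (j + s) (j' + s)) ≫ φ i j' (by lia) = 0) :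
    ∃ a : (modifiedTensorDegree (shiftComplex L s) n).obj X ⟶ A,
      ∀ i j h, shiftι X L s i j n h ≫ a = φ i j h := by
  refine ⟨modifiedDesc (L := shiftComplex L s) φ ?_, fun i j h => modifiedι_desc _ _ i j h⟩
  intro i j i' j' hi hj h
  have := hφ i j i' j' hi hj h
  have hij' : i + j' = n := by clear hφ this; lia
  have hsm : s.negOnePow • ((tensorBifunctor R).obj (X.X i)).map (L.d (j + s) (j' + s)) ≫
      φ i j' hij' = (s.negOnePow • ((tensorBifunctor R).obj (X.X i)).map
        (L.d (j + s) (j' + s))) ≫ φ i j' hij' := by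
    rw [Linear.units_smul_comp]
  rw [mul_smul, hsm] at this
  refine Eq.trans ?_ this
  rw [map_shiftComplex_d]
  rfl

/-- The relations for the shifted complex carry an extra factor `(-1)^s`. Rescaling the generator in
bidegree `(i, j)` by `(-1)^(i * s)` absorbs it, since lowering `i` by one changes the scale by
exactly `(-1)^s`. -/
theorem exists_shiftIso (n : ℤ) :
    ∃ a : (modifiedTensorDegree (shiftComplex L s) n).obj X ≅
        (modifiedTensorDegree L (n + s)).obj X, ∀ i j h,
      shiftι X L s i j n h ≫ a.hom =
        (i * s).negOnePow • modifiedι X L i (j + s) (n + s) (by lia) := by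
  have hsgn (i : ℤ) : ((i + 1) * s).negOnePow = s.negOnePow * (i * s).negOnePow := by
    rw [← Int.negOnePow_add]; congr 1; ring
  have hs : s.negOnePow * s.negOnePow = 1 := Int.units_mul_self _
  have hc {i j j' : ℤ} (h : j = j') (h1 : i + j = n) (h2 : i + j' = n) :
      ((tensorBifunctor R).obj (X.X i)).map (L.XIsoOfEq (congrArg (· + s) h)).hom ≫
        shiftι X L s i j' n h2 = shiftι X L s i j n h1 := by
    subst h
    simp
  obtain ⟨a, ha⟩ : ∃ a : (modifiedTensorDegree (shiftComplex L s) n).obj X ⟶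
      (modifiedTensorDegree L (n + s)).obj X, ∀ i j h,
      shiftι X L s i j n h ≫ a =
        (i * s).negOnePow • modifiedι X L i (j + s) (n + s) (by lia) := by
    apply exists_shift_desc
    intro i j i' j' hi hj hij
    subst hi
    rw [hsgn, Linear.comp_units_smul, Linear.comp_units_smul, smul_smul,
      show (i' + 1).negOnePow * s.negOnePow * (s.negOnePow * (i' * s).negOnePow) =
        (i' * s).negOnePow * (i' + 1).negOnePow by
          rw [mul_assoc, ← mul_assoc s.negOnePow, hs, one_mul, mul_comm], mul_smul,
      ← smul_add, modifiedι_rel (X := X) (L := L) rfl (by lia) (by lia), smul_zero]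
  obtain ⟨b, hb⟩ : ∃ b : (modifiedTensorDegree L (n + s)).obj X ⟶
      (modifiedTensorDegree (shiftComplex L s) n).obj X, ∀ i j (h : i + j = n),
      modifiedι X L i (j + s) (n + s) (by lia) ≫ b =
        (i * s).negOnePow • shiftι X L s i j n h := by
    have hb' (i j : ℤ) (h : i + j = n) : ((tensorBifunctor R).obj (X.X i)).map
        (L.XIsoOfEq (show j + s = j + s - s + s by lia)).hom ≫
        shiftι X L s i (j + s - s) n (by lia) = shiftι X L s i j n h :=
      hc (j := j) (j' := j + s - s) (by lia) _ _
    refine ⟨modifiedDesc (fun i j h => (i * s).negOnePow •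
        ((tensorBifunctor R).obj (X.X i)).map (L.XIsoOfEq (show j = j - s + s by lia)).hom ≫
        shiftι X L s i (j - s) n (by lia)) ?_,
        fun i j h => (modifiedι_desc _ _ i (j + s) _).trans
          (congrArg ((i * s).negOnePow • ·) (hb' i j h))⟩
    intro i j i' j' hi hj hij
    obtain ⟨j, rfl⟩ : ∃ m, j = m + s := ⟨j - s, by lia⟩
    obtain ⟨j', rfl⟩ : ∃ m, j' = m + s := ⟨j' - s, by lia⟩
    subst hi
    rw [hb' i' j (by lia), hb' (i' + 1) j' (by lia), hsgn, Linear.comp_units_smul,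
      Linear.comp_units_smul, smul_smul, ← mul_assoc, mul_comm _ (i' * s).negOnePow, mul_smul,
      ← smul_add, shiftι_rel X L s rfl (by lia) (by lia), smul_zero]
  refine ⟨⟨a, b, ?_, ?_⟩, ha⟩
  · apply modifiedTensor_hom_ext
    intro i j hij
    change shiftι X L s i j n hij ≫ _ = shiftι X L s i j n hij ≫ _
    rw [← Category.assoc, ha, Linear.units_smul_comp, hb i j hij, smul_smul, Int.units_mul_self,
      one_smul, Category.comp_id]
  · apply modifiedTensor_hom_ext
    intro i j hij
    obtain ⟨j, rfl⟩ : ∃ m, j = m + s := ⟨j - s, by lia⟩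
    rw [← Category.assoc, hb i j (by lia), Linear.units_smul_comp, ha, smul_smul,
      Int.units_mul_self, one_smul, Category.comp_id]

end

theorem exists_shiftNatIso (L : ChainComplex (ModuleCat.{u} R) ℤ) (s n : ℤ) :
    Nonempty (modifiedTensorDegree (shiftComplex L s) n ≅ modifiedTensorDegree L (n + s)) := by
  choose a ha using fun X => exists_shiftIso (R := R) X L s n
  refine ⟨NatIso.ofComponents a fun {X X'} f => modifiedTensor_hom_ext fun i j hij => ?_⟩
  have h1 : shiftι X L s i j n hij ≫ (modifiedTensorDegree (shiftComplex L s) n).map f =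
      ((tensorBifunctor R).map (f.f i)).app (L.X (j + s)) ≫ shiftι X' L s i j n hij :=
    modifiedι_naturality f i j n hij
  change shiftι X L s i j n hij ≫ _ = shiftι X L s i j n hij ≫ _
  refine (Category.assoc _ _ _).symm.trans ((congrArg (· ≫ (a X').hom) h1).trans ?_)
  rw [Category.assoc, ha, reassoc_of% (ha X), Linear.comp_units_smul, Linear.units_smul_comp,
    modifiedι_naturality]

theorem IsLevelComplex.shift {L : ChainComplex (ModuleCat.{u} R) ℤ} (hL : IsLevelComplex L)
    (s : ℤ) : IsLevelComplex (shiftComplex L s) := by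
  rw [isLevelComplex_iff] at hL ⊢
  intro X P hP n
  obtain ⟨e⟩ := exists_shiftNatIso L s n
  rw [exact_map_iff_of_iso e]
  exact hL X P hP (n + s)

end Shift

end GorensteinAC

namespace GorensteinAC

variable {R : Type u} [Ring R]

/-! ### The Hom-complex in terms of homotopies. -/

section HomComplex

variable {X Y L : ChainComplex (ModuleCat.{u} R) ℤ}

theorem homDifferential_apply {n m : ℤ} (f : HomCochain X L n) {p a c q : ℤ} (hc : p + n = c)
    (ha : a + n = q) (hq : p + m = q) :
    homDifferential X L n m f ⟨(p, q), hq⟩ =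
      f ⟨(p, c), hc⟩ ≫ L.d c q - n.negOnePow • (X.d p a ≫ f ⟨(a, q), ha⟩) := by
  subst hc
  obtain rfl : a = q - n := by lia
  rfl

theorem homComplex_acyclic_iff_exists : (homComplex X L).Acyclic ↔
    ∀ (n : ℤ) (f : HomCochain X L n), homDifferential X L n (n - 1) f = 0 →
      ∃ u : HomCochain X L (n + 1), homDifferential X L (n + 1) n u = f := by
  refine forall_congr' fun n => ?_
  rw [HomologicalComplex.exactAt_iff' _ (n + 1) n (n - 1) (ComplexShape.prev_eq' _ (by simp))
    (ComplexShape.next_eq' _ (by simp)), ShortComplex.ab_exact_iff]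
  rfl

/-- A map to a term of a shifted complex, as a map to the corresponding term of the complex. -/
def ofShift {A : ModuleCat.{u} R} {n q : ℤ} (g : A ⟶ (shiftComplex L n).X q) : A ⟶ L.X (q + n) := g

theorem ofShift_comp_d {A : ModuleCat.{u} R} {n q : ℤ} (g : A ⟶ (shiftComplex L n).X q) (r : ℤ) :
    ofShift (g ≫ (shiftComplex L n).d q r) =
      n.negOnePow • ofShift g ≫ L.d (q + n) (r + n) := by
  have h (g : A ⟶ L.X (q + n)) : g ≫ (n.negOnePow • L.d (q + n) (r + n)) =
      n.negOnePow • g ≫ L.d (q + n) (r + n) := by rw [Linear.comp_units_smul]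
  exact h g

theorem ofShift_comm {n : ℤ} (f : X ⟶ shiftComplex L n) (p a : ℤ) :
    ofShift (f.f p) ≫ L.d (p + n) (a + n) = n.negOnePow • X.d p a ≫ ofShift (f.f a) := by
  have h : n.negOnePow • ofShift (f.f p) ≫ L.d (p + n) (a + n) = X.d p a ≫ ofShift (f.f a) :=
    (ofShift_comp_d (f.f p) a).symm.trans (congrArg ofShift (f.comm p a))
  rw [← h, smul_smul, Int.units_mul_self, one_smul]

theorem exists_shiftHom {n : ℤ} (φ : ∀ p, X.X p ⟶ L.X (p + n))
    (h : ∀ p a, a + 1 = p → φ p ≫ L.d (p + n) (a + n) = n.negOnePow • X.d p a ≫ φ a) :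
    ∃ f : X ⟶ shiftComplex L n, ∀ p, ofShift (f.f p) = φ p := by
  refine ⟨{ f := φ, comm' := fun p a hpa => ?_ }, fun _ => rfl⟩
  refine (ofShift_comp_d (φ p) a).trans ?_
  change n.negOnePow • φ p ≫ L.d (p + n) (a + n) = X.d p a ≫ φ a
  rw [h p a hpa, smul_smul, Int.units_mul_self, one_smul]

theorem nullHomotopic_shift_iff {n : ℤ} (f : X ⟶ shiftComplex L n) :
    Nonempty (Homotopy f 0) ↔ ∃ s : ∀ i j, X.X i ⟶ L.X (j + n), ∀ i, ofShift (f.f i) =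
      X.d i (i - 1) ≫ s (i - 1) i + n.negOnePow • s i (i + 1) ≫ L.d (i + 1 + n) (i + n) := by
  constructor
  · rintro ⟨h⟩
    refine ⟨fun i j => ofShift (h.hom i j), fun i => ?_⟩
    have h1 := h.comm i
    rw [dNext_eq (i' := i - 1) _ (by simp), prevD_eq (j' := i + 1) _ (by simp),
      HomologicalComplex.zero_f, add_zero] at h1
    refine (congrArg ofShift h1).trans ?_
    refine congrArg (X.d i (i - 1) ≫ ofShift (h.hom (i - 1) i) + ·) ?_
    exact ofShift_comp_d (h.hom i (i + 1)) i
  · rintro ⟨s, hs⟩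
    let s' (i j : ℤ) (_ : (ComplexShape.down ℤ).Rel j i) : X.X i ⟶ (shiftComplex L n).X j := s i j
    have hf : f = Homotopy.nullHomotopicMap' s' := by
      ext1 i
      refine (hs i).trans (Eq.trans ?_ (Homotopy.nullHomotopicMap'_f (k₂ := i + 1) (k₁ := i)
        (k₀ := i - 1) (by simp) (by simp) s').symm)
      exact congrArg (X.d i (i - 1) ≫ s (i - 1) i + ·) (ofShift_comp_d (s' i (i + 1) rfl) i).symm
    rw [hf]
    exact ⟨Homotopy.nullHomotopy' _⟩

theorem homComplex_acyclic_iff : (homComplex X L).Acyclic ↔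
    ∀ (n : ℤ) (f : X ⟶ shiftComplex L n), Nonempty (Homotopy f 0) := by
  rw [homComplex_acyclic_iff_exists]
  refine forall_congr' fun n => ?_
  have hn : n.negOnePow * n.negOnePow = 1 := Int.units_mul_self _
  constructor
  · intro h f
    obtain ⟨v, hv⟩ := h (fun k => ofShift (f.f k.1.1) ≫ (L.XIsoOfEq k.2).hom) (by
      funext ⟨⟨p, q⟩, hq⟩
      obtain ⟨a, rfl⟩ : ∃ a, q = a + n := ⟨q - n, by lia⟩
      refine (homDifferential_apply _ (c := p + n) (a := a) rfl rfl hq).trans ?_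
      simp [ofShift_comm])
    rw [nullHomotopic_shift_iff]
    classical
    -- The Hom differential in degree `n + 1` puts `(-1)^n` on the term `d v`, whereas the homotopy
    -- formula puts it on `s d`; multiplying `v` by `(-1)^n` exchanges the two.
    refine ⟨fun i j => if hij : i + 1 = j then
      n.negOnePow • v ⟨(i, j + n), by subst hij; ring⟩ else 0, fun i => ?_⟩
    have h1 := congrFun hv ⟨(i, i + n), rfl⟩
    rw [homDifferential_apply (n := n + 1) v (c := i + 1 + n) (a := i - 1) (by ring) (by ring)
      rfl] at h1
    simp only [HomologicalComplex.XIsoOfEq_rfl, Iso.refl_hom, Category.comp_id] at h1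
    rw [← h1]
    dsimp only
    rw [dif_pos (sub_add_cancel i 1), dif_pos rfl]
    simp only [Linear.comp_units_smul, Linear.units_smul_comp, smul_smul, hn, one_smul,
      Int.negOnePow_succ, Units.neg_smul, sub_neg_eq_add]
    exact add_comm _ _
  · intro h f hf
    obtain ⟨φ, hφ⟩ := exists_shiftHom (fun p => f ⟨(p, p + n), rfl⟩) (fun p a hpa => by
      have h1 := congrFun hf ⟨(p, a + n), by subst hpa; ring⟩
      rw [homDifferential_apply (n := n) f (c := p + n) (a := a) rfl rfl] at h1
      exact sub_eq_zero.1 h1)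
    obtain ⟨s, hs⟩ := (nullHomotopic_shift_iff φ).1 (h φ)
    let w : HomCochain X L (n + 1) := fun k =>
      n.negOnePow • s k.1.1 (k.1.2 - n) ≫ (L.XIsoOfEq (sub_add_cancel k.1.2 n)).hom
    have hw (p r : ℤ) (h : p + (n + 1) = r + n) : w ⟨(p, r + n), h⟩ = n.negOnePow • s p r := by
      have (t : ℤ) (ht : t = r) : s p t ≫ (L.XIsoOfEq (congrArg (· + n) ht)).hom = s p r := by
        subst ht
        exact Category.comp_id _
      exact congrArg (n.negOnePow • ·) (this (r + n - n) (add_sub_cancel_right r n))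
    refine ⟨w, ?_⟩
    funext ⟨⟨p, q⟩, hq⟩
    change p + n = q at hq
    subst hq
    rw [homDifferential_apply (n := n + 1) w (c := p + 1 + n) (a := p - 1) (by lia) (by lia), hw, hw]
    refine Eq.trans ?_ ((hs p).symm.trans (hφ p))
    simp only [Linear.comp_units_smul, Linear.units_smul_comp, smul_smul, hn, one_smul,
      Int.negOnePow_succ, Units.neg_smul, sub_neg_eq_add, neg_mul]
    exact add_comm _ _

/-- The map of Hom-complexes induced by a chain map in the first variable. -/
def homComplexMap (f : X ⟶ Y) (L : ChainComplex (ModuleCat.{u} R) ℤ) :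
    homComplex Y L ⟶ homComplex X L where
  f n := AddCommGrpCat.ofHom
    { toFun := fun g k => f.f k.1.1 ≫ g k
      map_zero' := by funext; simp
      map_add' := fun _ _ => by funext; simp }
  comm' n m _ := by
    refine AddCommGrpCat.hom_ext (AddMonoidHom.ext fun g => ?_)
    funext ⟨⟨p, q⟩, hq⟩
    change (f.f p ≫ g ⟨(p, p + n), rfl⟩) ≫ L.d (p + n) q -
      n.negOnePow • (X.d p (q - n) ≫ f.f (q - n) ≫ g ⟨(q - n, q), by lia⟩) =
      f.f p ≫ (g ⟨(p, p + n), rfl⟩ ≫ L.d (p + n) q -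
      n.negOnePow • (Y.d p (q - n) ≫ g ⟨(q - n, q), by lia⟩))
    simp

theorem homComplex_shortExact {S : ShortComplex (ChainComplex (ModuleCat.{u} R) ℤ)}
    (hS : S.ShortExact) (L : ChainComplex (ModuleCat.{u} R) ℤ)
    (hL : ∀ i j (v : S.X₁.X i ⟶ L.X j), ∃ w : S.X₂.X i ⟶ L.X j, S.f.f i ≫ w = v) :
    (ShortComplex.mk (homComplexMap S.g L) (homComplexMap S.f L) (by
      ext1 n
      refine AddCommGrpCat.hom_ext (AddMonoidHom.ext fun g => ?_)
      funext k
      change S.f.f _ ≫ S.g.f _ ≫ g k = 0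
      rw [← Category.assoc, ← HomologicalComplex.comp_f, S.zero]
      exact zero_comp)).ShortExact := by
  refine HomologicalComplex.shortExact_of_degreewise_shortExact _ fun n => ?_
  have hS' (i : ℤ) := (HomologicalComplex.shortExact_iff_degreewise_shortExact S).1 hS i
  have hg (i : ℤ) : Epi (S.g.f i) := (hS' i).epi_g
  refine { exact := ?_, mono_f := ?_, epi_g := ?_ }
  · rw [ShortComplex.ab_exact_iff]
    intro (g : HomCochain S.X₂ L n) hg0
    have hk (k) : S.f.f k.1.1 ≫ g k = 0 := congrFun hg0 k
    have hd (k) : ∃ h : S.X₃.X k.1.1 ⟶ L.X k.1.2, S.g.f k.1.1 ≫ h = g k :=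
      have : Epi (S.map (HomologicalComplex.eval _ _ k.1.1)).g := hg k.1.1
      ⟨(hS' k.1.1).exact.desc (g k) (hk k), (hS' k.1.1).exact.g_desc (g k) (hk k)⟩
    choose h hh using hd
    exact ⟨h, funext hh⟩
  · rw [AddCommGrpCat.mono_iff_injective]
    intro (g : HomCochain S.X₃ L n) (g' : HomCochain S.X₃ L n) h
    funext k
    exact (cancel_epi (S.g.f k.1.1)).1 (congrFun h k)
  · rw [AddCommGrpCat.epi_iff_surjective]
    intro (g : HomCochain S.X₁ L n)
    choose w hw using fun k => hL _ _ (g k)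
    exact ⟨w, funext hw⟩

end HomComplex

theorem acyclic_left_of_shortExact {S : ShortComplex (ChainComplex AddCommGrpCat.{u} ℤ)}
    (hS : S.ShortExact) (h₂ : S.X₂.Acyclic) (h₃ : S.X₃.Acyclic) : S.X₁.Acyclic := by
  intro j
  refine hS.exactAt_X₁ j ?_ fun i _ => ?_
  · exact ⟨fun _ _ _ => ((h₂ j).isZero_homology).eq_of_tgt _ _⟩
  · exact ⟨fun _ _ _ => ((h₃ i).isZero_homology).eq_of_src _ _⟩

theorem acyclic_right_of_shortExact {S : ShortComplex (ChainComplex AddCommGrpCat.{u} ℤ)}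
    (hS : S.ShortExact) (h₁ : S.X₁.Acyclic) (h₂ : S.X₂.Acyclic) : S.X₃.Acyclic := by
  intro j
  refine hS.exactAt_X₃ j ?_ fun i _ => ?_
  · exact ⟨fun _ _ _ => ((h₂ j).isZero_homology).eq_of_src _ _⟩
  · exact ⟨fun _ _ _ => ((h₁ i).isZero_homology).eq_of_tgt _ _⟩

/-! ### Contractible and projective complexes. -/

section Contractible

variable {X Y P L : ChainComplex (ModuleCat.{u} R) ℤ}

/-- A complex is contractible if its identity map is null homotopic. -/
def IsContractible (P : ChainComplex (ModuleCat.{u} R) ℤ) : Prop := Nonempty (Homotopy (𝟙 P) 0)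

theorem IsContractible.nullHomotopic (hP : IsContractible P) (f : P ⟶ Y) :
    Nonempty (Homotopy f 0) := by
  obtain ⟨h⟩ := hP
  exact ⟨(Homotopy.ofEq (Category.id_comp f).symm).trans
    ((h.compRight f).trans (Homotopy.ofEq zero_comp))⟩

theorem IsContractible.homComplex_acyclic (hP : IsContractible P)
    (L : ChainComplex (ModuleCat.{u} R) ℤ) : (homComplex P L).Acyclic :=
  homComplex_acyclic_iff.2 fun _ f => hP.nullHomotopic f

theorem _root_.Homotopy.eq_nullHomotopicMap {f : X ⟶ Y} (h : Homotopy f 0) :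
    f = Homotopy.nullHomotopicMap h.hom := by
  ext1 i
  exact (h.comm i).trans (add_zero _)

/-- The homotopy is extended instead of the map. Its components may be extended independently, and
the null homotopic map they define is automatically a chain map. -/
theorem exists_extension_of_homotopy {ι : X ⟶ P}
    (hι : ∀ i j (v : X.X i ⟶ L.X j), ∃ w : P.X i ⟶ L.X j, ι.f i ≫ w = v)
    {f : X ⟶ L} (hf : Nonempty (Homotopy f 0)) : ∃ g : P ⟶ L, ι ≫ g = f := by
  obtain ⟨h⟩ := hf
  choose w hw using fun i j => hι i j (h.hom i j)
  refine ⟨Homotopy.nullHomotopicMap w, ?_⟩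
  rw [Homotopy.comp_nullHomotopicMap]
  simp only [hw]
  exact h.eq_nullHomotopicMap.symm

/-- Dually, each component of the contracting homotopy, followed by the given map, is lifted through
the epimorphism, and the lifts define a null homotopic chain map. -/
theorem IsContractible.projective (hP : IsContractible P) (hproj : ∀ n, Projective (P.X n)) :
    Projective P := by
  obtain ⟨s⟩ := hP
  refine ⟨fun {E Y} f p _ => ?_⟩
  have (n : ℤ) : Epi (p.f n) :=
    inferInstanceAs (Epi ((HomologicalComplex.eval (ModuleCat.{u} R) _ n).map p))
  refine ⟨Homotopy.nullHomotopicMap fun i j => s.hom i j ≫ Projective.factorThru (f.f j) (p.f j),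
    ?_⟩
  rw [Homotopy.nullHomotopicMap_comp]
  simp only [Category.assoc, Projective.factorThru_comp]
  rw [← Homotopy.nullHomotopicMap_comp, ← s.eq_nullHomotopicMap, Category.id_comp]

theorem IsContractible.of_retract (hP : IsContractible P) {i : X ⟶ P} {r : P ⟶ X}
    (h : i ≫ r = 𝟙 X) : IsContractible X := by
  obtain ⟨s⟩ := hP.nullHomotopic r
  exact ⟨(Homotopy.ofEq h.symm).trans ((s.compLeft i).trans (Homotopy.ofEq comp_zero))⟩

section Cone

variable (A B : ℤ → ModuleCat.{u} R) (e : ∀ n, B (n + 1) ≅ A n)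

/-- The complex `A_n ⊞ B_n` with differential `(a, b) ↦ (e b, 0)`, for isomorphisms
`e : B_{n+1} ≅ A_n`. -/
noncomputable def cone : ChainComplex (ModuleCat.{u} R) ℤ :=
  ChainComplex.of (fun n => A n ⊞ B n) (fun n => biprod.snd ≫ (e n).hom ≫ biprod.inl)
    (fun n => by simp)

theorem cone_d (n : ℤ) : (cone A B e).d (n + 1) n = biprod.snd ≫ (e n).hom ≫ biprod.inl :=
  ChainComplex.of_d (fun n => A n ⊞ B n) (fun n => biprod.snd ≫ (e n).hom ≫ biprod.inl) n

theorem cone_isContractible : IsContractible (cone A B e) := by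
  let s (i j : ℤ) (hij : (ComplexShape.down ℤ).Rel j i) :
      (cone A B e).X i ⟶ (cone A B e).X j :=
    (show A i ⊞ B i ⟶ A (i + 1) ⊞ B (i + 1) from biprod.fst ≫ (e i).inv ≫ biprod.inr) ≫
      ((cone A B e).XIsoOfEq (show i + 1 = j from hij)).hom
  have h : 𝟙 (cone A B e) = Homotopy.nullHomotopicMap' s := by
    ext1 n
    obtain ⟨m, rfl⟩ : ∃ m, n = m + 1 := ⟨n - 1, by lia⟩
    rw [Homotopy.nullHomotopicMap'_f (k₂ := m + 1 + 1) (k₁ := m + 1) (k₀ := m) rfl rfl, cone_d,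
      cone_d]
    have hs (i : ℤ) : s i (i + 1) rfl = biprod.fst ≫ (e i).inv ≫ biprod.inr := Category.comp_id _
    rw [hs, hs]
    change 𝟙 (A (m + 1) ⊞ B (m + 1)) = (biprod.snd ≫ (e m).hom ≫ biprod.inl) ≫
      biprod.fst ≫ (e m).inv ≫ biprod.inr + (biprod.fst ≫ (e (m + 1)).inv ≫ biprod.inr) ≫
      biprod.snd ≫ (e (m + 1)).hom ≫ biprod.inl
    simp only [Category.assoc, biprod.inl_fst_assoc, biprod.inr_snd_assoc, Iso.hom_inv_id_assoc,
      Iso.inv_hom_id_assoc]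
    exact biprod.total.symm.trans (add_comm _ _)
  exact ⟨(Homotopy.ofEq h).trans (Homotopy.nullHomotopy' s)⟩

theorem cone_projective (hA : ∀ n, Projective (A n)) (hB : ∀ n, Projective (B n)) :
    Projective (cone A B e) :=
  (cone_isContractible A B e).projective fun n => inferInstanceAs (Projective (A n ⊞ B n))

variable {A B}

/-- The chain map to `cone A B e` with components `(j, d j')`. -/
noncomputable def toCone (X : ChainComplex (ModuleCat.{u} R) ℤ) (j : ∀ n, X.X n ⟶ A n)
    (j' : ∀ n, X.X n ⟶ B n) (h : ∀ n, j' (n + 1) ≫ (e n).hom = X.d (n + 1) n ≫ j n)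
    (h' : ∀ n, X.d (n + 1) n ≫ j' n = 0) : X ⟶ cone A B e where
  f n := biprod.lift (j n) (j' n)
  comm' n m hnm := by
    change m + 1 = n at hnm
    subst hnm
    rw [cone_d]
    change biprod.lift _ _ ≫ biprod.snd ≫ (e m).hom ≫ biprod.inl =
      X.d (m + 1) m ≫ biprod.lift (j m) (j' m)
    apply biprod.hom_ext
    · simp [h]
    · simp [h']

end Cone

/-- The natural epimorphism from a contractible complex. -/
noncomputable def fromCone (X : ChainComplex (ModuleCat.{u} R) ℤ) :
    cone (fun n => X.X (n + 1)) (fun n => X.X n) (fun _ => Iso.refl _) ⟶ X where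
  f n := biprod.desc (X.d (n + 1) n) (𝟙 _)
  comm' n m hnm := by
    change m + 1 = n at hnm
    subst hnm
    rw [cone_d]
    change biprod.desc _ _ ≫ X.d (m + 1) m = (biprod.snd ≫ 𝟙 _ ≫ biprod.inl) ≫ biprod.desc _ _
    apply biprod.hom_ext' <;> simp

/-- A projective complex is a retract of the contractible cone that surjects onto it. -/
theorem isContractible_of_projective (P : ChainComplex (ModuleCat.{u} R) ℤ) [Projective P] :
    IsContractible P := by
  have (n : ℤ) : Epi ((fromCone P).f n) := by
    have h : (biprod.inr : P.X n ⟶ P.X (n + 1) ⊞ P.X n) ≫ (fromCone P).f n = 𝟙 _ :=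
      biprod.inr_desc _ _
    exact (IsSplitEpi.mk' ⟨_, h⟩ : IsSplitEpi ((fromCone P).f n)).epi
  have : Epi (fromCone P) := HomologicalComplex.epi_of_epi_f _ this
  exact (cone_isContractible _ _ _).of_retract (Projective.factorThru_comp (𝟙 P) (fromCone P))

end Contractible

end GorensteinAC

namespace GorensteinAC

open scoped ZeroObject

variable {R : Type u} [Ring R]

theorem IsGorensteinACProjectiveModule.of_projective (M : ModuleCat.{u} R) [Projective M] :
    IsGorensteinACProjectiveModule M := by
  refine isGorensteinProjectiveFor_of_classes (𝓛 := IsLevelModule) Projective Projective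
    (fun _ h => h) (fun P hP => ?_) (fun P hP => ?_) (X := M) inferInstance
  · refine ⟨0, ⟨P, 𝟙 P, 0, comp_zero, hP, ?_, fun L _ u => ⟨u, Category.id_comp u⟩⟩, inferInstance⟩
    exact ShortComplex.Splitting.shortExact ⟨𝟙 P, 0, by simp, by simp, by simp⟩
  · refine ⟨0, ⟨P, 0, 𝟙 P, zero_comp, hP, ?_, fun L _ u => ⟨0, (isZero_zero _).eq_of_src _ _⟩⟩,
      inferInstance⟩
    exact ShortComplex.Splitting.shortExact ⟨0, 𝟙 P, by simp, by simp, by simp⟩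

/-! ### Necessity: termwise Gorenstein projectivity and null homotopies. -/

section Eval

variable {X : ChainComplex (ModuleCat.{u} R) ℤ}

/-- A complete resolution is tested against the level complexes `disk L k`; chain maps into such a
disk are module maps from degree `k - 1` to `L`. -/
theorem IsGorensteinACProjectiveComplex.eval (hX : IsGorensteinACProjectiveComplex X) (n : ℤ) :
    IsGorensteinACProjectiveModule (X.X n) := by
  obtain ⟨P, hP, hex, ⟨e⟩, hL⟩ := hX
  obtain ⟨k, rfl⟩ : ∃ k, n = k - 1 := ⟨n + 1, by lia⟩
  let F := HomologicalComplex.eval (ModuleCat.{u} R) (ComplexShape.down ℤ) (k - 1)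
  refine ⟨(F.mapHomologicalComplex _).obj P, fun i => ?_, fun i => ?_, ⟨?_⟩, fun L hLL => ?_⟩
  · have := hP i
    exact projective_eval (P.X i) (k - 1)
  · have h := hex i
    rw [HomologicalComplex.exactAt_iff] at h
    exact h.map F
  · exact F.mapIso e ≪≫ PreservesKernel.iso F (P.d 0 1)
  · rw [yoneda_acyclic_iff]
    intro i (g : (P.X (i + 1)).X (k - 1) ⟶ L) hg
    obtain ⟨h, hh⟩ := (yoneda_acyclic_iff P (disk L k)).1 (hL _ (isLevelComplex_disk hLL k)) i
      (toDisk g) (toDisk_ext (by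
        rw [HomologicalComplex.comp_f, Category.assoc, toDisk_f_bot]
        exact hg.trans zero_comp.symm))
    refine ⟨h.f (k - 1) ≫ (diskBot L k).hom, ?_⟩
    refine (Category.assoc _ _ _).symm.trans ?_
    change ((P.d (i + 1) (i + 1 + 1)) ≫ h).f (k - 1) ≫ _ = _
    rw [hh, toDisk_f_bot]

/-- The map factors through a projective complex, which is contractible. -/
theorem IsGorensteinACProjectiveComplex.nullHomotopic (hX : IsGorensteinACProjectiveComplex X)
    {L : ChainComplex (ModuleCat.{u} R) ℤ} (hL : IsLevelComplex L) (f : X ⟶ L) :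
    Nonempty (Homotopy f 0) := by
  obtain ⟨_, ⟨P, ι, _, _, _, _, hext⟩, _⟩ := hX.exists_syzygyRel
  obtain ⟨g, rfl⟩ := hext L hL f
  obtain ⟨h⟩ := (isContractible_of_projective P).nullHomotopic g
  exact ⟨(h.compLeft ι).trans (Homotopy.ofEq comp_zero)⟩

theorem IsLevelComplex.homComplex_acyclic_of_nullHomotopic
    {L : ChainComplex (ModuleCat.{u} R) ℤ} (hL : IsLevelComplex L)
    (h : ∀ L : ChainComplex (ModuleCat.{u} R) ℤ, IsLevelComplex L →
      ∀ f : X ⟶ L, Nonempty (Homotopy f 0)) : (homComplex X L).Acyclic :=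
  homComplex_acyclic_iff.2 fun n f => h _ (hL.shift n) f

/-- A complex is isomorphic to its shift by zero. -/
noncomputable def shiftZeroIso (L : ChainComplex (ModuleCat.{u} R) ℤ) :
    L ≅ shiftComplex L 0 :=
  HomologicalComplex.Hom.isoOfComponents (fun i => L.XIsoOfEq (add_zero i).symm) (by
    intro i j _
    change (L.XIsoOfEq (add_zero i).symm).hom ≫ ((0 : ℤ).negOnePow • L.d (i + 0) (j + 0)) =
      L.d i j ≫ (L.XIsoOfEq (add_zero j).symm).hom
    simp)

theorem nullHomotopic_of_homComplex_acyclic {L : ChainComplex (ModuleCat.{u} R) ℤ}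
    (h : (homComplex X L).Acyclic) (f : X ⟶ L) : Nonempty (Homotopy f 0) := by
  obtain ⟨s⟩ := homComplex_acyclic_iff.1 h 0 (f ≫ (shiftZeroIso L).hom)
  exact ⟨(Homotopy.ofEq (by simp)).trans ((s.compRight (shiftZeroIso L).inv).trans
    (Homotopy.ofEq zero_comp))⟩

end Eval

/-! ### Sufficiency: continuing a complex in both directions. -/

section Syzygies

variable {X : ChainComplex (ModuleCat.{u} R) ℤ}

theorem syzygyRel_of_homComplex_acyclic {S : ShortComplex (ChainComplex (ModuleCat.{u} R) ℤ)}
    (hS : S.ShortExact) (hP : Projective S.X₂)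
    (hext : ∀ i (N : ModuleCat.{u} R), IsLevelModule N →
      ∀ v : S.X₁.X i ⟶ N, ∃ w : S.X₂.X i ⟶ N, S.f.f i ≫ w = v)
    (hX : ∀ L, IsLevelComplex L → (homComplex S.X₁ L).Acyclic) :
    SyzygyRel IsLevelComplex S.X₁ S.X₃ :=
  ⟨S.X₂, S.f, S.g, S.zero, hP, hS, fun L hL f =>
    exists_extension_of_homotopy (fun i j v => hext i _ (hL.isLevelModule j) v)
      (nullHomotopic_of_homComplex_acyclic (hX L hL) f)⟩

/-- Any projective presentation works: `Ext¹` vanishing of the terms of `X` makes the Hom-complexes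
short exact, the middle one is acyclic by contractibility, and acyclicity passes to the kernel. -/
theorem exists_left_syzygy (h : ∀ n, ExtVanishing IsLevelModule (X.X n))
    (hX : ∀ L, IsLevelComplex L → (homComplex X L).Acyclic) :
    ∃ K, SyzygyRel IsLevelComplex K X ∧ (∀ n, ExtVanishing IsLevelModule (K.X n)) ∧
      ∀ L, IsLevelComplex L → (homComplex K L).Acyclic := by
  let S := ShortComplex.mk _ _ (kernel.condition (Projective.π X))
  have hS : S.ShortExact := { exact := ShortComplex.exact_of_f_is_kernel _ (kernelIsKernel _) }
  have hS' := (HomologicalComplex.shortExact_iff_degreewise_shortExact S).1 hS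
  have hP : Projective S.X₂ := Projective.projective_over X
  have hext (i : ℤ) (N : ModuleCat.{u} R) (hN : IsLevelModule N) (v : S.X₁.X i ⟶ N) :
      ∃ w : S.X₂.X i ⟶ N, S.f.f i ≫ w = v :=
    extend_of_ext_eq_zero (hS' i) (h i N hN 0) v
  have hK (L) (hL : IsLevelComplex L) : (homComplex S.X₁ L).Acyclic :=
    acyclic_right_of_shortExact
      (homComplex_shortExact hS L fun i j v => hext i _ (hL.isLevelModule j) v) (hX L hL)
      ((isContractible_of_projective S.X₂).homComplex_acyclic L)
  refine ⟨S.X₁, syzygyRel_of_homComplex_acyclic hS hP hext hK, fun n => ?_, hK⟩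
  have := projective_eval S.X₂ n
  exact ExtVanishing.of_epi (hS' n) (.of_projective _ (S.X₂.X n)) (h n)

/-- The cokernel of a map `(j, j') : M ⟶ A ⊞ B` is Gorenstein AC-projective if `B` is projective
and the cokernel of the monomorphism `j` is Gorenstein AC-projective. -/
theorem IsGorensteinACProjectiveModule.cokernel_lift {M A B : ModuleCat.{u} R} [Projective B]
    (j : M ⟶ A) (j' : M ⟶ B) [Mono j] (h : IsGorensteinACProjectiveModule (cokernel j)) :
    IsGorensteinACProjectiveModule (cokernel (biprod.lift j j')) := by
  let U : ShortComplex (ModuleCat.{u} R) :=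
    ShortComplex.mk (biprod.inr : B ⟶ A ⊞ B) biprod.fst (by simp)
  have hU : U.ShortExact := ShortComplex.Splitting.shortExact
    ⟨biprod.snd, biprod.inl, by simp [U], by simp [U], by simp [U, add_comm, biprod.total]⟩
  -- Mapping `0 ⟶ 0 ⟶ M ⟶ M ⟶ 0` into `0 ⟶ B ⟶ A ⊞ B ⟶ A ⟶ 0` and taking cokernels presents the
  -- desired cokernel as an extension of `cokernel j` by `B`.
  let T : ShortComplex (ModuleCat.{u} R) := ShortComplex.mk (0 : 0 ⟶ M) (𝟙 M) zero_comp
  have hT : T.ShortExact := ShortComplex.Splitting.shortExact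
    ⟨0, 𝟙 M, by simp [T], by simp [T], by simp [T]⟩
  let φ : T ⟶ U :=
    { τ₁ := 0
      τ₂ := biprod.lift j j'
      τ₃ := j
      comm₁₂ := by simp [T]
      comm₂₃ := by simp [T, U] }
  have : Mono φ.τ₃ := ‹Mono j›
  have hc := shortExact_cokernel φ hT hU
  have h₁ : IsGorensteinACProjectiveModule (cokernel φ).X₁ :=
    (IsGorensteinACProjectiveModule.of_projective B).of_iso
      (PreservesCokernel.iso ShortComplex.π₁ φ ≪≫ cokernelZeroIsoTarget).symm
  have h₃ : IsGorensteinACProjectiveModule (cokernel φ).X₃ :=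
    h.of_iso (PreservesCokernel.iso ShortComplex.π₃ φ).symm
  exact (IsGorensteinProjectiveFor.of_shortExact (fun P _ => isLevelModule_of_projective P) hc
    h₁ h₃).of_iso (PreservesCokernel.iso ShortComplex.π₂ φ)

/-- A family of maps `j` from the terms of `X` to projective modules `Q` extends to a chain map from
`X` to a projective complex with terms `Q_n ⊞ Q_{n-1}`. -/
theorem exists_map_cone (X : ChainComplex (ModuleCat.{u} R) ℤ) (Q : ℤ → ModuleCat.{u} R)
    (hQ : ∀ n, Projective (Q n)) (j : ∀ n, X.X n ⟶ Q n) :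
    ∃ (E : ChainComplex (ModuleCat.{u} R) ℤ) (ι : X ⟶ E), Projective E ∧
      ∃ φ : ∀ n, E.X n ≅ Q n ⊞ Q (n - 1),
        ∀ n, ι.f n ≫ (φ n).hom = biprod.lift (j n) (X.d n (n - 1) ≫ j (n - 1)) := by
  have key (B : ℤ → ModuleCat.{u} R) (hB : ∀ n, Projective (B n)) (e : ∀ n, B (n + 1) ≅ Q n)
      (j' : ∀ n, X.X n ⟶ B n) (h : ∀ n, j' (n + 1) ≫ (e n).hom = X.d (n + 1) n ≫ j n)
      (h' : ∀ n, X.d (n + 1) n ≫ j' n = 0) :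
      ∃ (E : ChainComplex (ModuleCat.{u} R) ℤ) (ι : X ⟶ E), Projective E ∧
        ∃ φ : ∀ n, E.X n ≅ Q n ⊞ B n, ∀ n, ι.f n ≫ (φ n).hom = biprod.lift (j n) (j' n) :=
    ⟨cone Q B e, toCone e X j j' h h', cone_projective _ _ e hQ hB, fun _ => Iso.refl _,
      fun _ => Category.comp_id _⟩
  have he (n m : ℤ) (hm : m = n) :
      (X.d (n + 1) m ≫ j m) ≫ (eqToIso (congrArg Q hm)).hom = X.d (n + 1) n ≫ j n := by
    subst hm
    exact Category.comp_id _
  apply key (fun n => Q (n - 1)) (fun n => hQ (n - 1))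
    (fun n => eqToIso (congrArg Q (add_sub_cancel_right n 1)))
  · intro n
    exact he n (n + 1 - 1) (add_sub_cancel_right n 1)
  · simp

/-- The termwise embeddings `j` need not commute with differentials; adding the component `d j`
makes them a chain map and leaves `ι` mono through its first component. The Ext vanishing used for
extending maps is that of the terms of the cokernel. -/
theorem exists_right_syzygy (h : ∀ n, IsGorensteinACProjectiveModule (X.X n))
    (hX : ∀ L, IsLevelComplex L → (homComplex X L).Acyclic) :
    ∃ Y, SyzygyRel IsLevelComplex X Y ∧ (∀ n, IsGorensteinACProjectiveModule (Y.X n)) ∧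
      ∀ L, IsLevelComplex L → (homComplex Y L).Acyclic := by
  choose C hC hCg using fun n => (h n).exists_syzygyRel
  choose Q j q w hQ hjq _ using hC
  have hj (n) : Mono (j n) := (hjq n).mono_f
  obtain ⟨E, ι, hE, φ, hφ⟩ := exists_map_cone X Q hQ j
  have hι (n : ℤ) : Mono (ι.f n) := by
    have h1 : ι.f n ≫ (φ n).hom ≫ biprod.fst = j n := by
      rw [← Category.assoc, hφ, biprod.lift_fst]
    have : Mono (ι.f n ≫ (φ n).hom ≫ biprod.fst) := h1 ▸ hj n
    exact mono_of_mono (ι.f n) ((φ n).hom ≫ biprod.fst)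
  have : Mono ι := HomologicalComplex.mono_of_mono_f _ hι
  let S := ShortComplex.mk _ _ (cokernel.condition ι)
  have hS : S.ShortExact :=
    { exact := ShortComplex.exact_of_g_is_cokernel _ (cokernelIsCokernel _) }
  have hS' := (HomologicalComplex.shortExact_iff_degreewise_shortExact S).1 hS
  have hY (n : ℤ) : IsGorensteinACProjectiveModule (S.X₃.X n) := by
    have hn : IsGorensteinACProjectiveModule (cokernel (j n)) :=
      (hCg n).of_iso (cokernelIsoOfShortExact (hjq n)).symm
    exact (hn.cokernel_lift (j n) (X.d n (n - 1) ≫ j (n - 1))).of_iso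
      (cokernel.mapIso _ (ι.f n) (Iso.refl (X.X n)) (φ n).symm (by simp [← hφ]) ≪≫
        cokernelIsoOfShortExact (hS' n))
  have hext (i : ℤ) (N : ModuleCat.{u} R) (hN : IsLevelModule N) (v : S.X₁.X i ⟶ N) :
      ∃ w : S.X₂.X i ⟶ N, S.f.f i ≫ w = v :=
    extend_of_ext_eq_zero (hS' i) ((hY i).extVanishing N hN 0) v
  have hP : Projective S.X₂ := hE
  refine ⟨S.X₃, syzygyRel_of_homComplex_acyclic hS hP hext hX, hY, fun L hL => ?_⟩
  exact acyclic_left_of_shortExact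
    (homComplex_shortExact hS L fun i j v => hext i _ (hL.isLevelModule j) v)
    ((isContractible_of_projective S.X₂).homComplex_acyclic L) (hX L hL)

theorem isGorensteinACProjectiveComplex_of_homComplex_acyclic
    (h : ∀ n, IsGorensteinACProjectiveModule (X.X n))
    (hX : ∀ L, IsLevelComplex L → (homComplex X L).Acyclic) :
    IsGorensteinACProjectiveComplex X :=
  isGorensteinProjectiveFor_of_classes
    (fun X => (∀ n, IsGorensteinACProjectiveModule (X.X n)) ∧
      ∀ L, IsLevelComplex L → (homComplex X L).Acyclic)
    (fun X => (∀ n, ExtVanishing IsLevelModule (X.X n)) ∧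
      ∀ L, IsLevelComplex L → (homComplex X L).Acyclic)
    (fun _ h => ⟨fun n => (h.1 n).extVanishing, h.2⟩)
    (fun _ h => exists_right_syzygy h.1 h.2) (fun _ h => exists_left_syzygy h.1 h.2) ⟨h, hX⟩

end Syzygies

end GorensteinAC

theorem mainTheorem7 {R : Type u} [Ring R] (X : ChainComplex (ModuleCat.{u} R) ℤ) :
    (GorensteinAC.IsGorensteinACProjectiveComplex X ↔
      (∀ n : ℤ, GorensteinAC.IsGorensteinACProjectiveModule (X.X n)) ∧
      ∀ L : ChainComplex (ModuleCat.{u} R) ℤ, GorensteinAC.IsLevelComplex L →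
        (GorensteinAC.homComplex X L).Acyclic) ∧
    (GorensteinAC.IsGorensteinACProjectiveComplex X ↔
      (∀ n : ℤ, GorensteinAC.IsGorensteinACProjectiveModule (X.X n)) ∧
      ∀ L : ChainComplex (ModuleCat.{u} R) ℤ, GorensteinAC.IsLevelComplex L →
        ∀ f : X ⟶ L, Nonempty (Homotopy f 0)) := by
  have h12 : GorensteinAC.IsGorensteinACProjectiveComplex X ↔
      (∀ n : ℤ, GorensteinAC.IsGorensteinACProjectiveModule (X.X n)) ∧
      ∀ L : ChainComplex (ModuleCat.{u} R) ℤ, GorensteinAC.IsLevelComplex L →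
        (GorensteinAC.homComplex X L).Acyclic :=
    ⟨fun h => ⟨h.eval, fun _ hL => hL.homComplex_acyclic_of_nullHomotopic
      fun _ hL' => h.nullHomotopic hL'⟩, fun h =>
      GorensteinAC.isGorensteinACProjectiveComplex_of_homComplex_acyclic h.1 h.2⟩
  exact ⟨h12, fun h => ⟨h.eval, fun _ hL => h.nullHomotopic hL⟩, fun h =>
    h12.2 ⟨h.1, fun _ hL => hL.homComplex_acyclic_of_nullHomotopic h.2⟩⟩
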